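/- Let $n,m$ be natural numbers, let $u=(u_{(i,j),(k,l)})$ be a unitary $nm\times nm$ matrix with rows and columns indexed by $\{1,\dots,n\}\times\{1,\dots,m\}$, and let $\{e_i\}$, $\{f_j\}$ be the standard bases of $E=\mathbb C^n$, $F=\mathbb C^m$. On the Fock space $\mathcal F(n,m,u)=\bigoplus_{k,l\ge 0}E^{\otimes k}\otimes F^{\otimes l}$ let $L_{e_i}$ and $L_{f_j}$ be the left shifts by $e_i$ and $f_j$, where the vector produced by $L_{f_j}$ is rewritten as an element of $E^{\otimes k}\otimes F^{\otimes (l+1)}$ by repeated use of the identification $e_i\otimes f_j=\sum_{k,l}u_{(i,j),(k,l)}\,f_l\otimes e_k$. Let $\mathcal A_u$ and $\mathcal L_u$ be the norm closure and the weak$^*$ closure in $B(\mathcal F(n,m,u))$ of the unital algebra generated by the $L_{e_i}$ and $L_{f_j}$. Let $\mathbb B_n,\mathbb B_m$ be the open Euclidean unit balls. For each $(i,j)$ let $C_{(i,j)}$ be the $n\times m$ matrix with $(k,l)$ entry $u_{(i,j),(k,l)}-\delta_{ik}\delta_{jl}$. The core is $$\Omega_u^0=\{(z,w)\in\overline{\mathbb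 B}_n\times\overline{\mathbb B}_m : C_{(i,j)}w=0 \text{ and } C_{(i,j)}^{t}z=0 \text{ for all } i,j\}.$$ Let $(z,w)\in\Omega_u^0\cap(\mathbb B_n\times\mathbb B_m)$. For a point $(z',w')$ let $\alpha_{(z',w')}$ denote the character of $\mathcal A_u$ with $L_{e_i}\mapsto z'_i$ and $L_{f_j}\mapsto w'_j$, and also its weak$^*$-continuous extension to a character of $\mathcal L_u$. On $\mathcal A_u$ this character exists and is unique for $(z',w')=(0,w)$ and $(z,w)$, and on $\mathcal L_u$ the weak$^*$-continuous one exists and is unique for $(z',w')=(0,0)$ and $(z,w)$. An automorphism $\Theta$ is called unitarily implemented if there is a unitary operator $V$ on $\mathcal F(n,m,u)$ with $\Theta(X)=VXV^*$ for all $X$. Moreover: 1. There is a unitarily implemented automorphism $\tilde\Theta_z$ of $\mathcal A_u$ such that $\alpha_{(0,w)}(\tilde\Theta_z^{-1}(X))=\alpha_{(z,w)}(X)$ for every $X\in\mathcal A_u$. 2. There is a unitarily implemented automorphism $\Theta_{z,w}$ of $\mathcal L_u$ which is a homeomorphism for the weak$^*$ topology, which restricts to an automorphism of $\mathcal A_u$,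 and which satisfies $\alpha_{(0,0)}(\Theta_{z,w}^{-1}(X))=\alpha_{(z,w)}(X)$ for every $X\in\mathcal L_u$. -/

import Mathlib

/-! Operator algebras of a unitary commutation relation `u` on the Fock space of `ℂⁿ` and `ℂᵐ`. -/

namespace UnitaryRelation

section Ultraweak

variable (H : Type*) [NormedAddCommGroup H] [InnerProductSpace ℂ H]

/-- The weak-star (that is, ultraweak) topology on `B(H)`: the coarsest topology for which every
functional `A ↦ ∑ₖ ⟪ηₖ, A ξₖ⟫` is continuous, where `∑ ‖ξₖ‖² < ∞` and `∑ ‖ηₖ‖² < ∞`. -/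
@[reducible] noncomputable def weakStarTopology : TopologicalSpace (H →L[ℂ] H) :=
  ⨅ p : lp (fun _ : ℕ => H) 2 × lp (fun _ : ℕ => H) 2,
    TopologicalSpace.induced
      (fun A : H →L[ℂ] H => ∑' k, inner ℂ (p.2 k) (A (p.1 k))) inferInstance

variable {H}

theorem summable_pairing (ξ η : lp (fun _ : ℕ => H) 2) (A : H →L[ℂ] H) :
    Summable (fun k => ‖A‖ * (‖η k‖ ^ 2 + ‖ξ k‖ ^ 2)) := by
  have h (x : lp (fun _ : ℕ => H) 2) : Summable (fun k => ‖x k‖ ^ 2) := by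
    have := (lp.memℓp x).summable (by norm_num)
    simpa using this
  exact ((h η).add (h ξ)).mul_left _

theorem norm_pairing_le (ξ η : lp (fun _ : ℕ => H) 2) (A : H →L[ℂ] H) (k : ℕ) :
    ‖inner ℂ (η k) (A (ξ k))‖ ≤ ‖A‖ * (‖η k‖ ^ 2 + ‖ξ k‖ ^ 2) := by
  have h1 := norm_inner_le_norm (𝕜 := ℂ) (η k) (A (ξ k))
  have h2 := A.le_opNorm (ξ k)
  have h3 : ‖η k‖ * ‖A (ξ k)‖ ≤ ‖η k‖ * (‖A‖ * ‖ξ k‖) := by gcongr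
  have h4 : ‖η k‖ * ‖ξ k‖ ≤ ‖η k‖ ^ 2 + ‖ξ k‖ ^ 2 := by
    nlinarith [sq_nonneg (‖η k‖ - ‖ξ k‖), sq_nonneg ‖η k‖, sq_nonneg ‖ξ k‖]
  nlinarith [mul_le_mul_of_nonneg_left h4 (norm_nonneg A)]

theorem summable_inner_pairing (ξ η : lp (fun _ : ℕ => H) 2) (A : H →L[ℂ] H) :
    Summable (fun k => inner ℂ (η k) (A (ξ k))) :=
  Summable.of_norm_bounded (summable_pairing ξ η A) (norm_pairing_le ξ η A)

theorem pairing_add (ξ η : lp (fun _ : ℕ => H) 2) (A B : H →L[ℂ] H) :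
    ∑' k, inner ℂ (η k) ((A + B) (ξ k)) =
      ∑' k, inner ℂ (η k) (A (ξ k)) + ∑' k, inner ℂ (η k) (B (ξ k)) := by
  rw [← (summable_inner_pairing ξ η A).tsum_add (summable_inner_pairing ξ η B)]
  simp only [add_apply, inner_add_right]

theorem continuous_weakStar_pairing (ξ η : lp (fun _ : ℕ => H) 2) :
    @Continuous _ _ (weakStarTopology H) _
      (fun A : H →L[ℂ] H => ∑' k, inner ℂ (η k) (A (ξ k))) :=
  continuous_iInf_dom (i := (ξ, η)) continuous_induced_dom

theorem continuous_weakStar_rng {X : Type*} [t : TopologicalSpace X] (f : X → (H →L[ℂ] H))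
    (h : ∀ ξ η : lp (fun _ : ℕ => H) 2,
      Continuous (fun x => ∑' k, inner ℂ (η k) (f x (ξ k)))) :
    @Continuous _ _ t (weakStarTopology H) f :=
  continuous_iInf_rng.2 fun p => continuous_induced_rng.2 (h p.1 p.2)

/-- A bounded operator applied termwise to a square-summable sequence. -/
noncomputable def ampliate (B : H →L[ℂ] H) (ξ : lp (fun _ : ℕ => H) 2) :
    lp (fun _ : ℕ => H) 2 :=
  ⟨fun k => B (ξ k), by
    have hs := (lp.memℓp ξ).summable (by norm_num)
    apply memℓp_gen
    refine Summable.of_nonneg_of_le (fun k => by positivity) (fun k => ?_)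
      (hs.mul_left (‖B‖ ^ 2))
    have h := B.le_opNorm (ξ k)
    have h2 : ‖B (ξ k)‖ ^ 2 ≤ (‖B‖ * ‖ξ k‖) ^ 2 := by gcongr
    simpa [mul_pow] using h2⟩

variable [CompleteSpace H]

/-- Addition is jointly, and multiplication separately, continuous for the weak-star topology. -/
theorem isSemitopologicalSemiring_weakStar :
    @IsSemitopologicalSemiring (H →L[ℂ] H) (weakStarTopology H) _ := by
  refine @IsSemitopologicalSemiring.mk _ (weakStarTopology H) _
    (@ContinuousAdd.mk _ (weakStarTopology H) _ ?_)
    (@SeparatelyContinuousMul.mk _ (weakStarTopology H) _ ?_ ?_)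
  · refine continuous_weakStar_rng (t := @instTopologicalSpaceProd _ _ (weakStarTopology H)
      (weakStarTopology H)) _ fun ξ η => ?_
    have h := continuous_weakStar_pairing ξ η
    have h1 := @Continuous.add _ _ _ _ _ (@instTopologicalSpaceProd _ _ (weakStarTopology H)
      (weakStarTopology H)) _ _
      (@Continuous.comp _ _ _ (@instTopologicalSpaceProd _ _ (weakStarTopology H)
        (weakStarTopology H)) (weakStarTopology H) _ _ _ h
        (@continuous_fst _ _ (weakStarTopology H) (weakStarTopology H)))
      (@Continuous.comp _ _ _ (@instTopologicalSpaceProd _ _ (weakStarTopology H)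
        (weakStarTopology H)) (weakStarTopology H) _ _ _ h
        (@continuous_snd _ _ (weakStarTopology H) (weakStarTopology H)))
    convert h1 using 1
    funext p
    exact pairing_add ξ η p.1 p.2
  · intro B
    refine continuous_weakStar_rng (t := weakStarTopology H) _ fun ξ η => ?_
    convert continuous_weakStar_pairing ξ (ampliate (ContinuousLinearMap.adjoint B) η)
      using 4 with A k
    exact (ContinuousLinearMap.adjoint_inner_left B _ _).symm
  · intro B
    exact continuous_weakStar_rng (t := weakStarTopology H) _ fun ξ η =>
      continuous_weakStar_pairing (ampliate B ξ) η

theorem norm_le_weakStar :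
    (inferInstance : TopologicalSpace (H →L[ℂ] H)) ≤ weakStarTopology H := by
  refine continuous_id_iff_le.1 (continuous_weakStar_rng _ fun ξ η => ?_)
  let f : (H →L[ℂ] H) →ₗ[ℂ] ℂ :=
    { toFun := fun A => ∑' k, inner ℂ (η k) (A (ξ k))
      map_add' := pairing_add ξ η
      map_smul' := fun c A => by
        simp [tsum_mul_left] }
  refine (f.mkContinuous (∑' k, (‖η k‖ ^ 2 + ‖ξ k‖ ^ 2)) fun A => ?_).continuous
  have h := tsum_of_norm_bounded (summable_pairing ξ η A).hasSum (norm_pairing_le ξ η A)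
  rw [tsum_mul_left, mul_comm] at h
  exact h

/-- The closure of a unital subalgebra of `B(H)` in the weak-star topology. -/
noncomputable def weakStarClosure (S : Subalgebra ℂ (H →L[ℂ] H)) :
    Subalgebra ℂ (H →L[ℂ] H) :=
  @Subalgebra.topologicalClosure (R := ℂ) (A := H →L[ℂ] H) _ _ (weakStarTopology H) _
    isSemitopologicalSemiring_weakStar S

theorem coe_weakStarClosure (S : Subalgebra ℂ (H →L[ℂ] H)) :
    (weakStarClosure S : Set (H →L[ℂ] H)) = @closure _ (weakStarTopology H) S := rfl

theorem topologicalClosure_le_weakStarClosure (S : Subalgebra ℂ (H →L[ℂ] H)) :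
    S.topologicalClosure ≤ weakStarClosure S :=
  closure.mono norm_le_weakStar

/-- The weak-star topology of a subalgebra of `B(H)`: the relative one. -/
@[reducible] noncomputable def relWeakStar (S : Subalgebra ℂ (H →L[ℂ] H)) : TopologicalSpace S :=
  TopologicalSpace.induced Subtype.val (weakStarTopology H)

/-- `Θ` is implemented by a unitary operator: `Θ X = V X V*`. -/
def UnitarilyImplemented {S : Subalgebra ℂ (H →L[ℂ] H)} (Θ : S ≃ₐ[ℂ] S) : Prop :=
  ∃ V ∈ unitary (H →L[ℂ] H), ∀ X : S, (Θ X : H →L[ℂ] H) = V * X * star V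

end Ultraweak

/-- The Fock space `⨁_{k,l} (ℂⁿ)^{⊗k} ⊗ (ℂᵐ)^{⊗l}`, in the coordinates given by its orthonormal
basis `e_{i₁} ⊗ ⋯ ⊗ e_{iₖ} ⊗ f_{j₁} ⊗ ⋯ ⊗ f_{jₗ}`, which is indexed by pairs of words. -/
abbrev Fock (n m : ℕ) : Type := lp (fun _ : List (Fin n) × List (Fin m) => ℂ) 2

variable {n m : ℕ}

/-- The basis vector `e_a ⊗ f_b` for words `a`, `b`. -/
noncomputable def basisVec (a : List (Fin n)) (b : List (Fin m)) : Fock n m :=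
  lp.single 2 (a, b) (1 : ℂ)

theorem inner_basisVec (a a' : List (Fin n)) (b b' : List (Fin m)) :
    inner ℂ (basisVec a b) (basisVec a' b') = if (a, b) = (a', b') then (1 : ℂ) else 0 := by
  rw [basisVec, lp.inner_single_left, basisVec, lp.single_apply]
  by_cases h : (a, b) = (a', b')
  · simp [h]
  · simp [h]

theorem orthonormal_shiftE (i : Fin n) :
    Orthonormal ℂ (fun p : List (Fin n) × List (Fin m) => basisVec (i :: p.1) p.2) := by
  rw [orthonormal_iff_ite]
  rintro ⟨a, b⟩ ⟨a', b'⟩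
  simp [inner_basisVec]

/-- The shift `L_{e_i}`, `e_a ⊗ f_b ↦ e_i ⊗ e_a ⊗ f_b`. -/
noncomputable def shiftE (i : Fin n) : Fock n m →L[ℂ] Fock n m :=
  (orthonormal_shiftE i).orthogonalFamily.linearIsometry.toContinuousLinearMap

theorem shiftE_basisVec (i : Fin n) (a : List (Fin n)) (b : List (Fin m)) :
    shiftE i (basisVec a b) = basisVec (i :: a) b := by
  have h := (orthonormal_shiftE (m := m) i).orthogonalFamily.linearIsometry_apply_single
    (i := (a, b)) (1 : ℂ)
  simpa [shiftE, basisVec] using h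

theorem inner_shiftE_same (i : Fin n) (x y : Fock n m) :
    inner ℂ (shiftE i x) (shiftE i y) = inner ℂ x y :=
  (orthonormal_shiftE i).orthogonalFamily.linearIsometry.inner_map_map x y

theorem inner_shiftE_ne {i i' : Fin n} (hi : i ≠ i') (x y : Fock n m) :
    inner ℂ (shiftE i x) (shiftE i' y) = 0 := by
  have hx := (orthonormal_shiftE (m := m) i).orthogonalFamily.hasSum_linearIsometry x
  have hy := (orthonormal_shiftE (m := m) i').orthogonalFamily.hasSum_linearIsometry y
  have h1 : ∀ p : List (Fin n) × List (Fin m),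
      inner ℂ (basisVec (i :: p.1) p.2) (shiftE i' y) = 0 := by
    intro p
    have := hy.mapL (innerSL ℂ (basisVec (i :: p.1) p.2))
    refine this.unique ?_
    convert hasSum_zero with q
    simp [inner_basisVec, hi]
  have h2 := hx.mapL (innerSL ℂ (shiftE i' y))
  rw [← inner_conj_symm]
  have h3 : inner ℂ (shiftE i' y) (shiftE i x) = (0 : ℂ) := by
    refine h2.unique ?_
    convert hasSum_zero with p
    have h4 := h1 p
    rw [inner_eq_zero_symm] at h4
    simp [h4]
  rw [h3, map_zero]

/-- The image `f_l ⊗ e_a ⊗ f_b` of a basis vector under `L_{f_l}`, rewritten in the basis by moving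
`f_l` to the right with `f_l ⊗ e_k = ∑_{i,j} conj u_{(i,j),(k,l)} e_i ⊗ f_j`. -/
noncomputable def shiftFVec (u : Matrix.unitaryGroup (Fin n × Fin m) ℂ) (b : List (Fin m)) :
    List (Fin n) → Fin m → Fock n m
  | [], l => basisVec [] (l :: b)
  | k :: a, l => ∑ p : Fin n × Fin m,
      star ((u : Matrix (Fin n × Fin m) (Fin n × Fin m) ℂ) p (k, l)) •
        shiftE p.1 (shiftFVec u b a p.2)

theorem inner_basisVec_nil_shiftE (b : List (Fin m)) (i : Fin n) (x : Fock n m) :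
    inner ℂ (basisVec [] b) (shiftE i x) = (0 : ℂ) := by
  have hx := (orthonormal_shiftE (m := m) i).orthogonalFamily.hasSum_linearIsometry x
  refine (hx.mapL (innerSL ℂ (basisVec [] b))).unique ?_
  convert hasSum_zero with q
  simp [inner_basisVec]

theorem inner_shiftFVec (u : Matrix.unitaryGroup (Fin n × Fin m) ℂ) (b b' : List (Fin m))
    (a : List (Fin n)) : ∀ (a' : List (Fin n)) (l l' : Fin m),
    inner ℂ (shiftFVec u b a l) (shiftFVec u b' a' l') =
      if (a, b, l) = (a', b', l') then (1 : ℂ) else 0 := by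
  induction a with
  | nil =>
    rintro (_ | ⟨k', a'⟩) l l'
    · simp [shiftFVec, inner_basisVec, and_comm]
    · simp [shiftFVec, inner_sum, inner_smul_right, inner_basisVec_nil_shiftE]
  | cons k a ih =>
    rintro (_ | ⟨k', a'⟩) l l'
    · simp only [shiftFVec, sum_inner, inner_smul_left]
      rw [if_neg (by simp)]
      refine Finset.sum_eq_zero fun p _ => ?_
      have h := inner_basisVec_nil_shiftE (l' :: b') p.1 (shiftFVec u b a p.2)
      rw [inner_eq_zero_symm] at h
      simp [h]
    · have hu := congrFun (congrFun (Matrix.UnitaryGroup.star_mul_self u) (k', l')) (k, l)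
      rw [Matrix.mul_apply] at hu
      have key (p q : Fin n × Fin m) :
          inner ℂ (shiftE p.1 (shiftFVec u b a p.2)) (shiftE q.1 (shiftFVec u b' a' q.2)) =
            if p = q then (if (a, b) = (a', b') then (1 : ℂ) else 0) else 0 := by
        obtain ⟨i, j⟩ := p
        obtain ⟨i', j'⟩ := q
        by_cases hi : i = i'
        · subst hi
          rw [inner_shiftE_same, ih]
          by_cases hj : j = j' <;> simp [hj]
        · simp [inner_shiftE_ne hi, hi]
      simp only [shiftFVec, sum_inner, inner_sum, inner_smul_left, inner_smul_right, key]
      simp only [mul_ite, mul_one, mul_zero, Finset.sum_ite_eq', Finset.mem_univ, if_true]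
      by_cases h : (a, b) = (a', b')
      · simp only [Prod.mk.injEq] at h
        obtain ⟨rfl, rfl⟩ := h
        simp only [Matrix.star_apply, Matrix.one_apply] at hu
        simp only [if_true, starRingEnd_apply, star_star]
        rw [← Finset.sum_congr rfl fun p _ => ?_, hu]
        · simp [eq_comm]
        · ring
      · simp only [h, if_false, ite_self, Finset.sum_const_zero]
        rw [if_neg]
        simp only [Prod.mk.injEq, List.cons.injEq] at h ⊢
        tauto

theorem orthonormal_shiftF (u : Matrix.unitaryGroup (Fin n × Fin m) ℂ) (l : Fin m) :
    Orthonormal ℂ (fun p : List (Fin n) × List (Fin m) => shiftFVec u p.2 p.1 l) := by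
  rw [orthonormal_iff_ite]
  rintro ⟨a, b⟩ ⟨a', b'⟩
  simp [inner_shiftFVec]

/-- The shift `L_{f_l}`, `e_a ⊗ f_b ↦ f_l ⊗ e_a ⊗ f_b`. -/
noncomputable def shiftF (u : Matrix.unitaryGroup (Fin n × Fin m) ℂ) (l : Fin m) :
    Fock n m →L[ℂ] Fock n m :=
  (orthonormal_shiftF u l).orthogonalFamily.linearIsometry.toContinuousLinearMap

theorem shiftF_basisVec (u : Matrix.unitaryGroup (Fin n × Fin m) ℂ) (l : Fin m)
    (a : List (Fin n)) (b : List (Fin m)) :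
    shiftF u l (basisVec a b) = shiftFVec u b a l := by
  have h := (orthonormal_shiftF u l).orthogonalFamily.linearIsometry_apply_single
    (i := (a, b)) (1 : ℂ)
  simpa [shiftF, basisVec] using h

/-- `ℂ[𝔽ᵤ⁺]`: the unital algebra generated by the shifts. (`L_e` and `L_f` for general vectors
`e`, `f` are linear combinations of the generators used here.) -/
noncomputable def semigroupAlgebra (u : Matrix.unitaryGroup (Fin n × Fin m) ℂ) :
    Subalgebra ℂ (Fock n m →L[ℂ] Fock n m) :=
  Algebra.adjoin ℂ (Set.range shiftE ∪ Set.range (shiftF u))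

/-- `𝒜ᵤ`: the norm closure of `ℂ[𝔽ᵤ⁺]`. -/
noncomputable def normAlg (u : Matrix.unitaryGroup (Fin n × Fin m) ℂ) :
    Subalgebra ℂ (Fock n m →L[ℂ] Fock n m) :=
  (semigroupAlgebra u).topologicalClosure

/-- `ℒᵤ`: the weak-star closure of `ℂ[𝔽ᵤ⁺]`. -/
noncomputable def weakStarAlg (u : Matrix.unitaryGroup (Fin n × Fin m) ℂ) :
    Subalgebra ℂ (Fock n m →L[ℂ] Fock n m) :=
  weakStarClosure (semigroupAlgebra u)

theorem normAlg_le_weakStarAlg (u : Matrix.unitaryGroup (Fin n × Fin m) ℂ) :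
    normAlg u ≤ weakStarAlg u :=
  topologicalClosure_le_weakStarClosure _

theorem shiftE_mem (u : Matrix.unitaryGroup (Fin n × Fin m) ℂ) (i : Fin n) :
    shiftE i ∈ normAlg u :=
  Subalgebra.le_topologicalClosure _ (Algebra.subset_adjoin (Or.inl ⟨i, rfl⟩))

theorem shiftF_mem (u : Matrix.unitaryGroup (Fin n × Fin m) ℂ) (j : Fin m) :
    shiftF u j ∈ normAlg u :=
  Subalgebra.le_topologicalClosure _ (Algebra.subset_adjoin (Or.inr ⟨j, rfl⟩))

/-- The matrix `C_{(i,j)} = u_{(i,j)} - E_{i,j}`, where `u_{(i,j)}` is the `n × m` matrix formed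
from the row `(i,j)` of `u`. -/
def coreMatrix (u : Matrix.unitaryGroup (Fin n × Fin m) ℂ) (i : Fin n) (j : Fin m) :
    Matrix (Fin n) (Fin m) ℂ :=
  Matrix.of (fun k l => (u : Matrix (Fin n × Fin m) (Fin n × Fin m) ℂ) (i, j) (k, l)) -
    Matrix.single i j 1

/-- The core `Ωᵤ⁰`. -/
def core (u : Matrix.unitaryGroup (Fin n × Fin m) ℂ) :
    Set (EuclideanSpace ℂ (Fin n) × EuclideanSpace ℂ (Fin m)) :=
  {p | ‖p.1‖ ≤ 1 ∧ ‖p.2‖ ≤ 1 ∧ ∀ i j, Matrix.mulVec (coreMatrix u i j) p.2 = 0 ∧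
    Matrix.mulVec (coreMatrix u i j).transpose p.1 = 0}

/-- `φ` is the character `α_{(z,w)}` of `𝒜ᵤ`: it maps `L_{e_i}` to `z_i` and `L_{f_j}` to `w_j`.
(A multiplicative linear functional on a Banach algebra is automatically continuous.) -/
def IsCharacterAt (u : Matrix.unitaryGroup (Fin n × Fin m) ℂ)
    (p : EuclideanSpace ℂ (Fin n) × EuclideanSpace ℂ (Fin m))
    (φ : normAlg u →ₐ[ℂ] ℂ) : Prop :=
  (∀ i, φ ⟨shiftE i, shiftE_mem u i⟩ = p.1 i) ∧ ∀ j, φ ⟨shiftF u j, shiftF_mem u j⟩ = p.2 j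

/-- `φ` is the weak-star continuous character of `ℒᵤ` that extends the character `α_{(z,w)}`
of `𝒜ᵤ`. -/
def IsWeakStarCharacterAt (u : Matrix.unitaryGroup (Fin n × Fin m) ℂ)
    (p : EuclideanSpace ℂ (Fin n) × EuclideanSpace ℂ (Fin m))
    (φ : weakStarAlg u →ₐ[ℂ] ℂ) : Prop :=
  @Continuous _ _ (relWeakStar (weakStarAlg u)) _ φ ∧
    IsCharacterAt u p (φ.comp (Subalgebra.inclusion (normAlg_le_weakStarAlg u)))

end UnitaryRelation

open UnitaryRelation

/-! Write S, T for the two tuples of shifts and Ω for the vacuum; put y = z̄ and s² = 1 - ‖z‖². The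
core condition says that `u` fixes z ⊗ f for every f. As `u` is unitary, so does its adjoint, and
together these make Y = ∑ yₖSₖ commute with every Tⱼ and Tⱼ*.

Let M be the image of S under the operator form of the ball involution exchanging 0 and z
(`mobius`). Since ‖Y‖ < 1, (1 - Y)⁻¹ is a norm limit of polynomials in S. Because Y commutes with Tⱼ
and Tⱼ*, the pair M, T satisfies the same relations as S, T (`DoublyCommuting.mobius`). The vector
s(1 - Y)⁻¹Ω is a cyclic vacuum for it (`FockSystem.mobius`), and because the transformation is an
involution, both pairs generate the same norm closed algebra (`topologicalClosure_adjoin_mobius`).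

The relations and a cyclic vacuum determine the system up to unitary equivalence
(`FockSystem.fockEquiv`). Hence some unitary conjugates S, T to M, T and preserves both closed
algebras (`FockSystem.exists_automorphism`). A character that kills every Sᵢ sends Mᵢ to ȳᵢ = zᵢ
(`algHom_mobius_eq`), so (0, w) moves to (z, w). Transforming T as well moves (0, 0) to (z, w). The
vacuum state is the character at the origin; its transports supply the other characters, and
continuity gives uniqueness. -/

namespace UnitaryRelation

/-! ### Algebra of the Möbius transform of a row isometry. -/

section Mobius

variable {ι κ A : Type*} [Fintype ι] [Fintype κ] [DecidableEq ι] [DecidableEq κ]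
  [Ring A] [StarRing A] [Algebra ℂ A] [StarModule ℂ A]

/-- Row isometries `S` and `T` that satisfy the commutation relations given by `u` and their
mixed-adjoint form. -/
structure DoublyCommuting (u : ι → κ → ι → κ → ℂ) (S : ι → A) (T : κ → A) : Prop where
  star_left_mul_left : ∀ i k, star (S i) * S k = if i = k then 1 else 0
  star_right_mul_right : ∀ j l, star (T j) * T l = if j = l then 1 else 0
  left_mul_right : ∀ i j, S i * T j = ∑ k, ∑ l, u i j k l • (T l * S k)
  right_mul_left : ∀ k l, T l * S k = ∑ i, ∑ j, star (u i j k l) • (S i * T j)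
  star_left_mul_right : ∀ i l, star (S i) * T l =
    ∑ k, ∑ j, star (u i j k l) • (T j * star (S k))

/-- The coefficients of the commutation relations after exchanging the two tuples. -/
def flipCoeff (u : ι → κ → ι → κ → ℂ) : κ → ι → κ → ι → ℂ := fun l k j i => star (u i j k l)

omit [Fintype ι] [Fintype κ] [DecidableEq ι] [DecidableEq κ] in
theorem flipCoeff_flipCoeff (u : ι → κ → ι → κ → ℂ) : flipCoeff (flipCoeff u) = u := by
  funext i j k l
  simp [flipCoeff]

namespace DoublyCommuting

variable {u : ι → κ → ι → κ → ℂ} {S : ι → A} {T : κ → A}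

theorem star_right_mul_left (h : DoublyCommuting u S T) (i : ι) (l : κ) :
    star (T l) * S i = ∑ k, ∑ j, u i j k l • (S k * star (T j)) := by
  have := congrArg star (h.star_left_mul_right i l)
  simpa [star_sum] using this

/-- The relations are symmetric in the two tuples once `u` is replaced by `flipCoeff u`, so results
about transforming `S` apply equally to `T`. -/
theorem flip (h : DoublyCommuting u S T) : DoublyCommuting (flipCoeff u) T S where
  star_left_mul_left := h.star_right_mul_right
  star_right_mul_right := h.star_left_mul_left
  left_mul_right l k := by
    rw [h.right_mul_left, Finset.sum_comm]
    rfl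
  right_mul_left j i := by
    rw [h.left_mul_right, Finset.sum_comm]
    simp [flipCoeff]
  star_left_mul_right l i := by
    rw [h.star_right_mul_left, Finset.sum_comm]
    simp [flipCoeff]

end DoublyCommuting

/-- `y` is fixed by the commutation relations: `∑ yᵢ Sᵢ` and `∑ ȳᵢ Sᵢ*` commute with all `Tⱼ`. -/
structure FixedBy (u : ι → κ → ι → κ → ℂ) (y : ι → ℂ) : Prop where
  sum_fst : ∀ j k l, ∑ i, y i * u i j k l = if j = l then y k else 0
  sum_snd : ∀ i j l, ∑ k, u i j k l * star (y k) = if j = l then star (y i) else 0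

/-- The image of a row isometry `S` under the involutive automorphism of the unit ball that
exchanges `0` and `ȳ`; here `s ^ 2 = 1 - ‖y‖ ^ 2`. -/
noncomputable def mobius (y : ι → ℂ) (s : ℝ) (S : ι → A) (i : ι) : A :=
  Ring.inverse (1 - ∑ k, y k • S k) *
    (star (y i) • (1 : A) - (s : ℂ) • S i - (star (y i) / (1 + s)) • ∑ k, y k • S k)

variable {u : ι → κ → ι → κ → ℂ} {S : ι → A} {T : κ → A} {y : ι → ℂ} {s : ℝ}

omit [DecidableEq ι] [StarRing A] [StarModule ℂ A] in
-- The coefficient ȳᵢ/(1 + s) in `mobius` is tuned for this: ‖y‖²/(1 + s) = 1 - s, so the terms sY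
-- and (1 - s)Y add up to Y.
theorem sum_smul_mobius (hs : 0 < s) (hy : ∑ i, star (y i) * y i = 1 - (s : ℂ) ^ 2) :
    ∑ i, y i • mobius y s S i =
      Ring.inverse (1 - ∑ k, y k • S k) * ((1 - (s : ℂ) ^ 2) • (1 : A) - ∑ k, y k • S k) := by
  have hs' : (1 + (s : ℂ)) ≠ 0 := by
    exact_mod_cast (by positivity : (1 + s) ≠ 0)
  simp only [mobius, ← mul_smul_comm, ← Finset.mul_sum]
  congr 1
  have h1 : ∑ i, y i • star (y i) • (1 : A) = (1 - (s : ℂ) ^ 2) • (1 : A) := by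
    simp only [smul_smul, ← Finset.sum_smul, ← hy, mul_comm]
  have h2 : ∑ i, y i • (s : ℂ) • S i = (s : ℂ) • ∑ k, y k • S k := by
    simp only [Finset.smul_sum, smul_comm (s : ℂ)]
  have h3 : ∑ i, y i • (star (y i) / (1 + (s : ℂ))) • ∑ k, y k • S k =
      (1 - (s : ℂ)) • ∑ k, y k • S k := by
    simp only [smul_smul, ← Finset.sum_smul]
    congr 1
    simp only [mul_div, mul_comm (y _) (star _)]
    rw [← Finset.sum_div, hy]
    field_simp
    ring
  simp only [smul_sub, Finset.sum_sub_distrib, h1, h2, h3]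
  module

omit [DecidableEq ι] [StarRing A] [StarModule ℂ A] in
theorem one_sub_sum_smul_mobius (hs : 0 < s) (hy : ∑ i, star (y i) * y i = 1 - (s : ℂ) ^ 2)
    (hu : IsUnit (1 - ∑ k, y k • S k)) :
    1 - ∑ i, y i • mobius y s S i = (s : ℂ) ^ 2 • Ring.inverse (1 - ∑ k, y k • S k) := by
  rw [sum_smul_mobius hs hy]
  have h := Ring.inverse_mul_cancel _ hu
  nth_rewrite 1 [← h]
  rw [← mul_sub, ← mul_one (Ring.inverse _), mul_assoc, ← mul_smul_comm]
  congr 1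
  rw [one_mul]
  module

omit [DecidableEq ι] [StarRing A] [StarModule ℂ A] in
theorem one_sub_mul_mobius (hu : IsUnit (1 - ∑ k, y k • S k)) (i : ι) :
    (1 - ∑ k, y k • S k) * mobius y s S i =
      star (y i) • (1 : A) - (s : ℂ) • S i - (star (y i) / (1 + s)) • ∑ k, y k • S k := by
  rw [mobius, ← mul_assoc, Ring.mul_inverse_cancel _ hu, one_mul]

omit [DecidableEq ι] [StarRing A] [StarModule ℂ A] in
theorem inverse_one_sub_sum_smul_mobius (hs : 0 < s)
    (hy : ∑ i, star (y i) * y i = 1 - (s : ℂ) ^ 2) (hu : IsUnit (1 - ∑ k, y k • S k)) :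
    IsUnit (1 - ∑ i, y i • mobius y s S i) ∧
    Ring.inverse (1 - ∑ i, y i • mobius y s S i) =
      ((s : ℂ) ^ 2)⁻¹ • (1 - ∑ k, y k • S k) := by
  have hs' : (s : ℂ) ≠ 0 := by exact_mod_cast hs.ne'
  have h := one_sub_sum_smul_mobius hs hy hu
  have h1 : (1 - ∑ i, y i • mobius y s S i) * (((s : ℂ) ^ 2)⁻¹ • (1 - ∑ k, y k • S k)) = 1 := by
    rw [h, smul_mul_smul_comm, Ring.inverse_mul_cancel _ hu,
      mul_inv_cancel₀ (pow_ne_zero 2 hs'), one_smul]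
  have h2 : (((s : ℂ) ^ 2)⁻¹ • (1 - ∑ k, y k • S k)) * (1 - ∑ i, y i • mobius y s S i) = 1 := by
    rw [h, smul_mul_smul_comm, Ring.mul_inverse_cancel _ hu,
      inv_mul_cancel₀ (pow_ne_zero 2 hs'), one_smul]
  exact ⟨⟨⟨_, _, h1, h2⟩, rfl⟩, Ring.inverse_unit ⟨_, _, h1, h2⟩⟩

omit [DecidableEq ι] [StarRing A] [StarModule ℂ A] in
-- The new resolvent is s⁻²(1 - Y), which cancels the factor (1 - Y)⁻¹ in every term and leaves an
-- identity linear in 1, Y and Sᵢ.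
theorem mobius_mobius (hs : 0 < s)
    (hy : ∑ i, star (y i) * y i = 1 - (s : ℂ) ^ 2) (hu : IsUnit (1 - ∑ k, y k • S k)) (i : ι) :
    mobius y s (mobius y s S) i = S i := by
  have hs' : (s : ℂ) ≠ 0 := by exact_mod_cast hs.ne'
  have hs1 : (1 + (s : ℂ)) ≠ 0 := by
    exact_mod_cast (by positivity : (1 + s) ≠ 0)
  rw [mobius, (inverse_one_sub_sum_smul_mobius hs hy hu).2, smul_mul_assoc, mul_sub, mul_sub,
    mul_smul_comm, mul_smul_comm, mul_smul_comm, one_sub_mul_mobius hu, sum_smul_mobius hs hy,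
    ← mul_assoc, Ring.mul_inverse_cancel _ hu, one_mul, mul_one]
  generalize ∑ k, y k • S k = Y
  match_scalars <;> field_simp <;> ring

/-- The adjoint of the resolvent never has to be computed: everything follows from the defining
equation of Mᵢ multiplied by 1 - Y, together with Sᵢ*Sₖ = δᵢₖ and Y*Y = 1 - s². -/
theorem star_mobius_mul_mobius (hS : ∀ i k, star (S i) * S k = if i = k then 1 else 0)
    (hs : 0 < s) (hy : ∑ i, star (y i) * y i = 1 - (s : ℂ) ^ 2)
    (hu : IsUnit (1 - ∑ k, y k • S k)) (i k : ι) :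
    star (mobius y s S i) * mobius y s S k = if i = k then 1 else 0 := by
  have hs' : (s : ℂ) ≠ 0 := by exact_mod_cast hs.ne'
  have hs1 : (1 + (s : ℂ)) ≠ 0 := by
    exact_mod_cast (by positivity : (1 + s) ≠ 0)
  have hYS (k : ι) : star (∑ k, y k • S k) * S k = star (y k) • (1 : A) := by
    simp [star_sum, Finset.sum_mul, hS]
  have hSY (k : ι) : star (S k) * (∑ k, y k • S k) = y k • (1 : A) := by
    simp [Finset.mul_sum, hS]
  have hYY : star (∑ k, y k • S k) * (∑ k, y k • S k) = (1 - (s : ℂ) ^ 2) • (1 : A) := by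
    rw [Finset.mul_sum, ← hy, Finset.sum_smul]
    refine Finset.sum_congr rfl fun i _ => ?_
    rw [mul_smul_comm, hYS, smul_smul, mul_comm]
  have hM := fun i => one_sub_mul_mobius (s := s) hu i
  generalize ∑ k, y k • S k = Y at *
  generalize mobius y s S = M at *
  have hd (i : ι) : M i - star (y i) • (1 : A) =
      Y * M i - (s : ℂ) • S i - (star (y i) / (1 + s)) • Y := by
    have := hM i
    rw [sub_mul, one_mul] at this
    rw [← sub_eq_zero] at this ⊢
    rw [← this]
    abel
  -- Multiply the adjoint of the i-th equation by the k-th. The right side contributes (1 - s²)Mᵢ*Mₖ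
  -- against Mᵢ*Mₖ on the left, so s²Mᵢ*Mₖ survives.
  have key := congrArg₂ (fun a b => star a * b) (hd i) (hd k)
  have e1 : star (Y * M i) * (Y * M k) = (1 - (s : ℂ) ^ 2) • (star (M i) * M k) := by
    rw [star_mul, mul_assoc, ← mul_assoc (star Y), hYY, smul_mul_assoc, one_mul, mul_smul_comm]
  have e2 : star (Y * M i) * S k = star (y k) • star (M i) := by
    rw [star_mul, mul_assoc, hYS, mul_smul_comm, mul_one]
  have e3 : star (Y * M i) * Y = (1 - (s : ℂ) ^ 2) • star (M i) := by
    rw [star_mul, mul_assoc, hYY, mul_smul_comm, mul_one]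
  have e4 : star (S i) * (Y * M k) = y i • M k := by
    rw [← mul_assoc, hSY, smul_mul_assoc, one_mul]
  have e5 : star Y * (Y * M k) = (1 - (s : ℂ) ^ 2) • M k := by
    rw [← mul_assoc, hYY, smul_mul_assoc, one_mul]
  simp only [star_sub, star_smul, sub_mul, mul_sub, smul_mul_assoc, mul_smul_comm, e1, e2, e3, e4,
    e5, hS, hSY, hYS, hYY, star_one, one_mul, mul_one, star_star] at key
  have hst : star (s : ℂ) = s := Complex.conj_ofReal s
  have hsd (a : ℂ) : star (a / (1 + (s : ℂ))) = star a / (1 + s) := by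
    simp
  simp only [hst, hsd, star_star] at key
  have : (s : ℂ) ^ 2 • (star (M i) * M k) = (s : ℂ) ^ 2 • (if i = k then 1 else 0 : A) := by
    generalize star (M i) * M k = X at *
    generalize (if i = k then 1 else 0 : A) = d at *
    rw [← sub_eq_zero] at key ⊢
    rw [← key]
    match_scalars <;> field_simp <;> ring
  exact (smul_right_injective A (pow_ne_zero 2 hs')) this

namespace DoublyCommuting

omit [StarModule ℂ A] in
theorem commute_right_sum (h : DoublyCommuting u S T) (hf : FixedBy u y) (j : κ) :
    Commute (T j) (∑ k, y k • S k) := by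
  symm
  simp only [Commute, SemiconjBy, Finset.sum_mul, Finset.mul_sum, smul_mul_assoc, mul_smul_comm,
    h.left_mul_right, Finset.smul_sum, smul_smul]
  rw [Finset.sum_comm]
  refine Finset.sum_congr rfl fun k _ => ?_
  rw [Finset.sum_comm]
  simp only [← Finset.sum_smul, hf.sum_fst, ite_smul, zero_smul, Finset.sum_ite_eq,
    Finset.mem_univ, if_true]

theorem commute_star_right_sum (h : DoublyCommuting u S T) (hf : FixedBy u y) (j : κ) :
    Commute (star (T j)) (∑ k, y k • S k) := by
  simp only [Commute, SemiconjBy, Finset.sum_mul, Finset.mul_sum, smul_mul_assoc, mul_smul_comm,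
    h.star_right_mul_left, Finset.smul_sum, smul_smul]
  rw [Finset.sum_comm]
  refine Finset.sum_congr rfl fun k _ => ?_
  rw [Finset.sum_comm]
  simp only [← Finset.sum_smul, hf.sum_fst, ite_smul, zero_smul, Finset.sum_ite_eq',
    Finset.mem_univ, if_true]

omit [DecidableEq ι] [DecidableEq κ] [StarRing A] [Algebra ℂ A] [StarModule ℂ A] in
theorem _root_.Commute.ringInverse_right {a b : A} (h : Commute a b) :
    Commute a (Ring.inverse b) := by
  by_cases hb : IsUnit b
  · obtain ⟨v, rfl⟩ := hb
    rw [Ring.inverse_unit]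
    exact h.units_inv_right
  · rw [Ring.inverse_non_unit _ hb]
    exact Commute.zero_right a

/-- The resolvent of Y commutes with Tⱼ and Tⱼ*, so it factors out of both sides of each relation.
The remaining numerator is linear in 1, Sᵢ and Y: the Sᵢ term obeys the old relation, and the other
two obey it because y is fixed by the coefficients. -/
theorem mobius (h : DoublyCommuting u S T) (hf : FixedBy u y) (hs : 0 < s)
    (hy : ∑ i, star (y i) * y i = 1 - (s : ℂ) ^ 2) (hu : IsUnit (1 - ∑ k, y k • S k)) :
    DoublyCommuting u (mobius y s S) T := by
  have hT (j : κ) := h.commute_right_sum hf j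
  have hT' (j : κ) := h.commute_star_right_sum hf j
  have hG (j : κ) : Commute (T j) (Ring.inverse (1 - ∑ k, y k • S k)) :=
    ((Commute.one_right _).sub_right (hT j)).ringInverse_right
  have hG' (j : κ) : Commute (star (T j)) (Ring.inverse (1 - ∑ k, y k • S k)) :=
    ((Commute.one_right _).sub_right (hT' j)).ringInverse_right
  have hsnd' (j : κ) (k : ι) (l : κ) :
      ∑ i, star (u i j k l) * star (y i) = if j = l then star (y k) else 0 := by
    have := congrArg star (hf.sum_fst j k l)
    rw [star_sum] at this
    simpa [apply_ite, mul_comm] using this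
  have left (R : A) (k : ι) : UnitaryRelation.mobius y s S k * R =
      Ring.inverse (1 - ∑ k, y k • S k) * (star (y k) • R - (s : ℂ) • (S k * R) -
        (star (y k) / (1 + s)) • ((∑ k, y k • S k) * R)) := by
    rw [UnitaryRelation.mobius, mul_assoc]
    congr 1
    rw [sub_mul, sub_mul, smul_mul_assoc, smul_mul_assoc, smul_mul_assoc, one_mul]
  have right (R : A) (hR : Commute R (∑ k, y k • S k))
      (hRG : Commute R (Ring.inverse (1 - ∑ k, y k • S k))) (k : ι) :
      R * UnitaryRelation.mobius y s S k =
      Ring.inverse (1 - ∑ k, y k • S k) * (star (y k) • R - (s : ℂ) • (R * S k) -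
        (star (y k) / (1 + s)) • ((∑ k, y k • S k) * R)) := by
    rw [UnitaryRelation.mobius, ← mul_assoc, hRG.eq, mul_assoc]
    congr 1
    rw [mul_sub, mul_sub, mul_smul_comm, mul_smul_comm, mul_smul_comm, mul_one, hR.eq]
  -- All three mixed relations are instances of this one, with R equal to T or T* and c a row of `u`
  -- or a conjugated column.
  have transfer (R : κ → A) (P : ι → κ → A) (i : ι) (j : κ) (P₀ : A)
      (c : ι → κ → ℂ) (hc : ∀ l, ∑ k, c k l * star (y k) = if j = l then star (y i) else 0)
      (hrel : P₀ = ∑ k, ∑ l, c k l • P k l) :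
      Ring.inverse (1 - ∑ k, y k • S k) * (star (y i) • R j - (s : ℂ) • P₀ -
        (star (y i) / (1 + s)) • ((∑ k, y k • S k) * R j)) =
      ∑ k, ∑ l, c k l • (Ring.inverse (1 - ∑ k, y k • S k) * (star (y k) • R l -
        (s : ℂ) • P k l - (star (y k) / (1 + s)) • ((∑ k, y k • S k) * R l))) := by
    have hk : ∑ k, ∑ l, (c k l * star (y k)) • R l = star (y i) • R j := by
      rw [Finset.sum_comm]
      simp only [← Finset.sum_smul, hc, ite_smul, zero_smul, Finset.sum_ite_eq,
        Finset.mem_univ, if_true]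
    have hk' : (star (y i) / (1 + (s : ℂ))) • ((∑ k, y k • S k) * R j) =
        ∑ k, ∑ l, (c k l * (star (y k) / (1 + s))) • ((∑ k, y k • S k) * R l) := by
      rw [div_eq_inv_mul, mul_smul, ← mul_smul_comm, ← hk]
      simp only [Finset.smul_sum, Finset.mul_sum, mul_smul_comm, smul_smul]
      refine Finset.sum_congr rfl fun k _ => Finset.sum_congr rfl fun l _ => ?_
      congr 1
      ring
    simp only [← mul_smul_comm, ← Finset.mul_sum]
    congr 1
    simp only [mul_smul_comm]
    rw [hrel, ← hk, hk']
    generalize ∑ k, y k • S k = Y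
    simp only [Finset.smul_sum, ← Finset.sum_sub_distrib]
    refine Finset.sum_congr rfl fun k _ => Finset.sum_congr rfl fun l _ => ?_
    module
  refine ⟨star_mobius_mul_mobius h.star_left_mul_left hs hy hu, h.star_right_mul_right,
    fun i j => ?_, fun k l => ?_, fun i l => ?_⟩
  · simp only [left, right _ (hT _) (hG _)]
    exact transfer T _ i j _ (u i j) (hf.sum_snd i j) (h.left_mul_right i j)
  · simp only [left, right _ (hT _) (hG _)]
    exact transfer T _ k l _ (fun i j => star (u i j k l))
      (fun j => by simpa [eq_comm] using hsnd' j k l) (h.right_mul_left k l)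
  -- The adjoint form Tₗ*Mᵢ is the one in which the resolvent factors out on the left.
  · have : star (T l) * UnitaryRelation.mobius y s S i =
        ∑ k, ∑ j, u i j k l • (UnitaryRelation.mobius y s S k * star (T j)) := by
      simp only [left, right _ (hT' _) (hG' _)]
      exact transfer (fun j => star (T j)) _ i l _ (fun k j => u i j k l)
        (fun j => by simpa [eq_comm] using hf.sum_snd i j l) (h.star_right_mul_left i l)
    simpa [star_sum] using congrArg star this

end DoublyCommuting

end Mobius
-- Fock systems and their stability under the Möbius transform.
section FockSystem

variable {ι κ H : Type*} [Fintype ι] [Fintype κ] [DecidableEq ι] [DecidableEq κ]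
  [NormedAddCommGroup H] [InnerProductSpace ℂ H] [CompleteSpace H]

/-- Doubly commuting row isometries with a cyclic unit vector `Ω` annihilated by their adjoints. -/
structure FockSystem (u : ι → κ → ι → κ → ℂ) (S : ι → H →L[ℂ] H) (T : κ → H →L[ℂ] H) (Ω : H) :
    Prop extends DoublyCommuting u S T where
  norm_vacuum : ‖Ω‖ = 1
  star_left_vacuum : ∀ i, star (S i) Ω = 0
  star_right_vacuum : ∀ j, star (T j) Ω = 0
  cyclic : ∀ x, (∀ X ∈ Algebra.adjoin ℂ (Set.range S ∪ Set.range T), inner ℂ (X Ω) x = (0 : ℂ)) →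
    x = 0

theorem FockSystem.flip {u : ι → κ → ι → κ → ℂ} {S : ι → H →L[ℂ] H} {T : κ → H →L[ℂ] H} {Ω : H}
    (h : FockSystem u S T Ω) : FockSystem (flipCoeff u) T S Ω where
  toDoublyCommuting := h.toDoublyCommuting.flip
  norm_vacuum := h.norm_vacuum
  star_left_vacuum := h.star_right_vacuum
  star_right_vacuum := h.star_left_vacuum
  cyclic := by
    rw [Set.union_comm]
    exact h.cyclic

theorem inverse_one_sub_mem {A : Type*} [NormedRing A] [CompleteSpace A] [Algebra ℂ A]
    {B : Subalgebra ℂ A} (hB : IsClosed (B : Set A)) {a : A} (ha : a ∈ B) (hn : ‖a‖ < 1) :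
    Ring.inverse (1 - a) ∈ B := by
  rw [NormedRing.inverse_one_sub a hn]
  have : (↑(Units.oneSub a hn)⁻¹ : A) = ∑' k : ℕ, a ^ k := rfl
  rw [this]
  exact tsum_mem hB fun k => B.pow_mem ha k

variable {u : ι → κ → ι → κ → ℂ} {S : ι → H →L[ℂ] H} {T : κ → H →L[ℂ] H} {Ω : H}
  {y : ι → ℂ} {s : ℝ}

omit [Fintype κ] [DecidableEq κ] in
theorem star_sum_smul_mul_sum_smul (hS : ∀ i k, star (S i) * S k = if i = k then 1 else 0)
    (hy : ∑ i, star (y i) * y i = 1 - (s : ℂ) ^ 2) :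
    star (∑ k, y k • S k) * (∑ k, y k • S k) = (1 - (s : ℂ) ^ 2) • (1 : H →L[ℂ] H) := by
  simp [star_sum, Finset.sum_mul, Finset.mul_sum, hS, ← hy, smul_smul, Finset.sum_smul, mul_comm]

omit [Fintype κ] [DecidableEq κ] in
theorem norm_sum_smul_lt_one (hS : ∀ i k, star (S i) * S k = if i = k then 1 else 0)
    (hs : 0 < s) (hs1 : s ≤ 1) (hy : ∑ i, star (y i) * y i = 1 - (s : ℂ) ^ 2) :
    ‖∑ k, y k • S k‖ < 1 := by
  have h := CStarRing.norm_star_mul_self (x := ∑ k, y k • S k)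
  rw [star_sum_smul_mul_sum_smul hS hy, norm_smul] at h
  have h1 : ‖(1 : H →L[ℂ] H)‖ ≤ 1 := ContinuousLinearMap.norm_id_le
  have h2 : ‖(1 - (s : ℂ) ^ 2)‖ = 1 - s ^ 2 := by
    rw [← Complex.ofReal_pow, ← Complex.ofReal_one, ← Complex.ofReal_sub, Complex.norm_real,
      Real.norm_of_nonneg]
    nlinarith
  rw [h2] at h
  have h3 : 0 ≤ 1 - s ^ 2 := by nlinarith
  nlinarith [mul_le_mul_of_nonneg_left h1 h3, norm_nonneg (∑ k, y k • S k), sq_pos_of_pos hs]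

omit [Fintype κ] [DecidableEq ι] [DecidableEq κ] in
theorem mobius_mem {B : Subalgebra ℂ (H →L[ℂ] H)} (hB : IsClosed (B : Set (H →L[ℂ] H)))
    (hS : ∀ i, S i ∈ B) (hn : ‖∑ k, y k • S k‖ < 1) (i : ι) : mobius y s S i ∈ B := by
  have hY : ∑ k, y k • S k ∈ B := sum_mem fun k _ => B.smul_mem (hS k) _
  exact B.mul_mem (inverse_one_sub_mem hB hY hn) (B.sub_mem (B.sub_mem (B.smul_mem B.one_mem _)
    (B.smul_mem (hS i) _)) (B.smul_mem hY _))

omit [Fintype κ] [DecidableEq κ] in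
-- One inclusion is the Neumann series of (1 - Y)⁻¹. The other is the same inclusion for the
-- transformed tuple, which is again a row isometry and transforms back to `S`.
theorem topologicalClosure_adjoin_mobius
    (hS : ∀ i k, star (S i) * S k = if i = k then 1 else 0)
    (hs : 0 < s) (hs1 : s ≤ 1) (hy : ∑ i, star (y i) * y i = 1 - (s : ℂ) ^ 2) :
    (Algebra.adjoin ℂ (Set.range (mobius y s S) ∪ Set.range T)).topologicalClosure =
      (Algebra.adjoin ℂ (Set.range S ∪ Set.range T)).topologicalClosure := by
  have hn := norm_sum_smul_lt_one hS hs hs1 hy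
  have hu : IsUnit (1 - ∑ k, y k • S k) := isUnit_one_sub_of_norm_lt_one hn
  have hn' := norm_sum_smul_lt_one (star_mobius_mul_mobius hS hs hy hu) hs hs1 hy
  have main (R R' : ι → H →L[ℂ] H) (hR : ∀ B : Subalgebra ℂ (H →L[ℂ] H),
      IsClosed (B : Set (H →L[ℂ] H)) → (∀ i, R i ∈ B) → ∀ i, R' i ∈ B) :
      (Algebra.adjoin ℂ (Set.range R' ∪ Set.range T)).topologicalClosure ≤
        (Algebra.adjoin ℂ (Set.range R ∪ Set.range T)).topologicalClosure := by
    refine Subalgebra.topologicalClosure_minimal (Algebra.adjoin_le ?_)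
      (Subalgebra.isClosed_topologicalClosure _)
    rintro _ (⟨i, rfl⟩ | ⟨j, rfl⟩)
    · exact hR _ (Subalgebra.isClosed_topologicalClosure _) (fun i =>
        Subalgebra.le_topologicalClosure _ (Algebra.subset_adjoin (Or.inl ⟨i, rfl⟩))) i
    · exact Subalgebra.le_topologicalClosure _ (Algebra.subset_adjoin (Or.inr ⟨j, rfl⟩))
  refine le_antisymm (main _ _ fun B hB h => mobius_mem hB h hn) (main _ _ fun B hB h i => ?_)
  rw [← mobius_mobius hs hy hu i]
  exact mobius_mem hB h hn' i

/-- The wandering vector of the transformed row isometry. -/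
noncomputable def mobiusVacuum (y : ι → ℂ) (s : ℝ) (S : ι → H →L[ℂ] H) (Ω : H) : H :=
  (s : ℂ) • Ring.inverse (1 - ∑ k, y k • S k) Ω

/-- The new vacuum Ω' is governed by (1 - Y)Ω' = sΩ and Y*Ω = 0. -/
theorem FockSystem.mobius (h : FockSystem u S T Ω) (hf : FixedBy u y) (hs : 0 < s) (hs1 : s ≤ 1)
    (hy : ∑ i, star (y i) * y i = 1 - (s : ℂ) ^ 2) :
    FockSystem u (mobius y s S) T (mobiusVacuum y s S Ω) := by
  have hs' : (s : ℂ) ≠ 0 := by exact_mod_cast hs.ne'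
  have hn := norm_sum_smul_lt_one h.star_left_mul_left hs hs1 hy
  have hu : IsUnit (1 - ∑ k, y k • S k) := isUnit_one_sub_of_norm_lt_one hn
  have hdc := h.toDoublyCommuting.mobius hf hs hy hu
  have hYY := star_sum_smul_mul_sum_smul h.star_left_mul_left hy
  have hYΩ : star (∑ k, y k • S k) Ω = 0 := by
    simp [star_sum, h.star_left_vacuum]
  have hGΩ : star (Ring.inverse (1 - ∑ k, y k • S k)) Ω = Ω := by
    have h1 : star (Ring.inverse (1 - ∑ k, y k • S k)) * star (1 - ∑ k, y k • S k) = 1 := by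
      rw [← star_mul, Ring.mul_inverse_cancel _ hu, star_one]
    have h2 : star (Ring.inverse (1 - ∑ k, y k • S k)) (star (1 - ∑ k, y k • S k) Ω) = Ω :=
      DFunLike.congr_fun h1 Ω
    rwa [star_sub, sub_apply, hYΩ, star_one, sub_zero] at h2
  have hDΩ : (1 - ∑ k, y k • S k) (mobiusVacuum y s S Ω) = (s : ℂ) • Ω := by
    rw [mobiusVacuum, map_smul]
    exact congrArg _ (DFunLike.congr_fun (Ring.mul_inverse_cancel _ hu) Ω)
  refine ⟨hdc, ?_, fun i => ?_, fun j => ?_, fun x hx => ?_⟩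
  -- The two summands are orthogonal since Y*Ω = 0, and ‖YΩ'‖² = (1 - s²)‖Ω'‖²; Pythagoras then
  -- forces ‖Ω'‖ = 1.
  · have h1 : mobiusVacuum y s S Ω =
        (s : ℂ) • Ω + (∑ k, y k • S k) (mobiusVacuum y s S Ω) := by
      rw [← hDΩ]
      simp
    have h2 : ‖(∑ k, y k • S k) (mobiusVacuum y s S Ω)‖ ^ 2 =
        (1 - s ^ 2) * ‖mobiusVacuum y s S Ω‖ ^ 2 := by
      have := ContinuousLinearMap.apply_norm_sq_eq_inner_adjoint_right (∑ k, y k • S k)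
        (mobiusVacuum y s S Ω)
      rw [this, ← ContinuousLinearMap.star_eq_adjoint]
      change RCLike.re (inner ℂ _ ((star (∑ k, y k • S k) * ∑ k, y k • S k) _)) = _
      rw [hYY, smul_apply, one_apply_eq_self, inner_smul_right, inner_self_eq_norm_sq_to_K]
      norm_cast
      exact (congrArg _ (Complex.ofReal_mul _ _).symm).trans (Complex.ofReal_re _)
    have h3 : inner ℂ ((s : ℂ) • Ω) ((∑ k, y k • S k) (mobiusVacuum y s S Ω)) = (0 : ℂ) := by
      rw [inner_smul_left, ← ContinuousLinearMap.adjoint_inner_left,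
        ← ContinuousLinearMap.star_eq_adjoint, hYΩ]
      simp
    have h4 := norm_add_sq_eq_norm_sq_add_norm_sq_of_inner_eq_zero _ _ h3
    rw [← h1] at h4
    rw [norm_smul, h.norm_vacuum] at h4
    have h5 : ‖(s : ℂ)‖ = s := by simp [abs_of_pos hs]
    rw [h5] at h4
    have h6 : s ^ 2 * (‖mobiusVacuum y s S Ω‖ ^ 2 - 1) = 0 := by nlinarith
    have h7 : ‖mobiusVacuum y s S Ω‖ ^ 2 = 1 := by
      have := (mul_eq_zero.1 h6).resolve_left (by positivity)
      linarith
    nlinarith [norm_nonneg (mobiusVacuum y s S Ω)]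
  · have h1 : star (UnitaryRelation.mobius y s S i) Ω = y i • Ω := by
      rw [UnitaryRelation.mobius, star_mul]
      simp [hGΩ, h.star_left_vacuum]
    have h2 : star (UnitaryRelation.mobius y s S i) * (∑ k, y k • UnitaryRelation.mobius y s S k) =
        y i • 1 := by
      simp [Finset.mul_sum, hdc.star_left_mul_left]
    have h3 := one_sub_sum_smul_mobius hs hy hu
    -- Here 1 - ∑ yₖMₖ = s²(1 - Y)⁻¹ is multiplied by Mᵢ*. Applied to Ω the right side vanishes, as
    -- Mᵢ*Ω = yᵢΩ.
    have h4 : star (UnitaryRelation.mobius y s S i) * (s : ℂ) ^ 2 •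
        Ring.inverse (1 - ∑ k, y k • S k) = star (UnitaryRelation.mobius y s S i) - y i • 1 := by
      rw [← h3, mul_sub, h2, mul_one]
    have h5 := congrArg (fun X => X Ω) h4
    simp [h1] at h5
    simp [mobiusVacuum, h5.resolve_left hs.ne']
  · have hT' := h.toDoublyCommuting.commute_star_right_sum hf j
    have hG' : Commute (star (T j)) (Ring.inverse (1 - ∑ k, y k • S k)) :=
      ((Commute.one_right _).sub_right hT').ringInverse_right
    have h2 : star (T j) (Ring.inverse (1 - ∑ k, y k • S k) Ω) =
        Ring.inverse (1 - ∑ k, y k • S k) (star (T j) Ω) := DFunLike.congr_fun hG'.eq Ω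
    rw [mobiusVacuum, map_smul, h2, h.star_right_vacuum, map_zero, smul_zero]
  · have hcl := topologicalClosure_adjoin_mobius (T := T) h.star_left_mul_left hs hs1 hy
    have hx' : ∀ X ∈ (Algebra.adjoin ℂ (Set.range S ∪ Set.range T)).topologicalClosure,
        inner ℂ (X (mobiusVacuum y s S Ω)) x = (0 : ℂ) := by
      rw [← hcl]
      intro X hX
      have hc : IsClosed {X : H →L[ℂ] H | inner ℂ (X (mobiusVacuum y s S Ω)) x = (0 : ℂ)} :=
        isClosed_eq (by fun_prop) continuous_const
      exact closure_minimal hx hc hX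
    refine h.cyclic x fun X hX => ?_
    have hle := Subalgebra.le_topologicalClosure (Algebra.adjoin ℂ (Set.range S ∪ Set.range T))
    have hY : ∑ k, y k • S k ∈ Algebra.adjoin ℂ (Set.range S ∪ Set.range T) :=
      Subalgebra.sum_mem _ fun k _ => by
        have hk : S k ∈ Algebra.adjoin ℂ (Set.range S ∪ Set.range T) :=
          Algebra.subset_adjoin (Or.inl ⟨k, rfl⟩)
        exact Subalgebra.smul_mem _ hk _
    -- X(1 - Y) sends Ω' to sXΩ, which reduces cyclicity of Ω' to that of Ω.
    have h1 := hx' (X * (1 - ∑ k, y k • S k))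
      (hle (Subalgebra.mul_mem _ hX (Subalgebra.sub_mem _ (Subalgebra.one_mem _) hY)))
    change inner ℂ (X ((1 - ∑ k, y k • S k) (mobiusVacuum y s S Ω))) x = (0 : ℂ) at h1
    rw [hDΩ, map_smul, inner_smul_left] at h1
    exact (mul_eq_zero.1 h1).resolve_left (by simpa using hs.ne')

end FockSystem
theorem sum_sum_comm {α β γ δ M : Type*} [Fintype α] [Fintype β] [Fintype γ] [Fintype δ]
    [AddCommMonoid M] (f : α → β → γ → δ → M) :
    ∑ a, ∑ b, ∑ c, ∑ d, f a b c d = ∑ c, ∑ d, ∑ a, ∑ b, f a b c d := by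
  have : ∑ p : α × β, ∑ q : γ × δ, f p.1 p.2 q.1 q.2 =
      ∑ q : γ × δ, ∑ p : α × β, f p.1 p.2 q.1 q.2 :=
    Finset.sum_comm
  simpa only [Fintype.sum_prod_type] using this

/-! ### The shifts form a Fock system. -/

section FockRepresentation

variable {n m : ℕ}

theorem ext_basisVec {E : Type*} [NormedAddCommGroup E] [NormedSpace ℂ E]
    {f g : Fock n m →L[ℂ] E} (h : ∀ a b, f (basisVec a b) = g (basisVec a b)) : f = g := by
  refine lp.ext_continuousLinearMap (by norm_num) fun p => ?_
  ext
  simpa [basisVec] using h p.1 p.2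

theorem norm_basisVec (a : List (Fin n)) (b : List (Fin m)) : ‖basisVec a b‖ = 1 := by
  rw [basisVec, lp.norm_single (by norm_num)]
  simp

/-- The matrix entries of `u` as a family of coefficients. -/
def coeff (u : Matrix.unitaryGroup (Fin n × Fin m) ℂ) :
    Fin n → Fin m → Fin n → Fin m → ℂ :=
  fun i j k l => (u : Matrix (Fin n × Fin m) (Fin n × Fin m) ℂ) (i, j) (k, l)

variable (u : Matrix.unitaryGroup (Fin n × Fin m) ℂ)

theorem sum_star_coeff_mul (i' k : Fin n) (j' l : Fin m) :
    ∑ i, ∑ j, star (coeff u i j k l) * coeff u i j i' j' = if (k, l) = (i', j') then 1 else 0 := by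
  have hu := congrFun (congrFun (Matrix.UnitaryGroup.star_mul_self u) (k, l)) (i', j')
  rw [Matrix.mul_apply, Fintype.sum_prod_type] at hu
  simpa [Matrix.one_apply, coeff] using hu

theorem sum_coeff_mul_star (i' k : Fin n) (j' l : Fin m) :
    ∑ i, ∑ j, coeff u k l i j * star (coeff u i' j' i j) =
      if (k, l) = (i', j') then 1 else 0 := by
  have hu := congrFun (congrFun (Unitary.coe_mul_star_self u) (k, l)) (i', j')
  rw [Matrix.mul_apply, Fintype.sum_prod_type] at hu
  simpa [Matrix.one_apply, coeff] using hu

theorem star_shiftE_mul_shiftE (i k : Fin n) :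
    star (shiftE i : Fock n m →L[ℂ] Fock n m) * shiftE k = if i = k then 1 else 0 := by
  ext1 x
  refine ext_inner_left ℂ fun v => ?_
  rw [ContinuousLinearMap.star_eq_adjoint, mul_apply_eq_comp,
    ContinuousLinearMap.adjoint_inner_right]
  split_ifs with h
  · rw [h, inner_shiftE_same, one_apply_eq_self]
  · rw [inner_shiftE_ne h]
    simp

theorem shiftF_mul_shiftE (k : Fin n) (l : Fin m) :
    shiftF u l * shiftE k = ∑ i, ∑ j, star (coeff u i j k l) • (shiftE i * shiftF u j) := by
  refine ext_basisVec fun a b => ?_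
  simp [shiftE_basisVec, shiftF_basisVec, shiftFVec, Fintype.sum_prod_type, coeff]

/-- This inverts `shiftF_mul_shiftE`, which is built into `shiftFVec`, by the orthonormality of the
rows of `u`. -/
theorem shiftE_mul_shiftF (i : Fin n) (j : Fin m) :
    shiftE i * shiftF u j = ∑ k, ∑ l, coeff u i j k l • (shiftF u l * shiftE k) := by
  simp only [shiftF_mul_shiftE, Finset.smul_sum, smul_smul]
  have : ∀ i' j', ∑ k, ∑ l, (coeff u i j k l * star (coeff u i' j' k l)) •
      (shiftE i' * shiftF u j') = if (i, j) = (i', j') then shiftE i' * shiftF u j' else 0 := by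
    intro i' j'
    simp only [← Finset.sum_smul, sum_coeff_mul_star, ite_smul, one_smul, zero_smul]
  calc _ = ∑ i', ∑ j', if (i, j) = (i', j') then shiftE i' * shiftF u j' else 0 := by
        simp [Prod.mk.injEq, ite_and]
    _ = _ := by
        simp only [← this]
        exact sum_sum_comm fun i' j' k l => (coeff u i j k l * star (coeff u i' j' k l)) •
          (shiftE i' * shiftF u j')

theorem star_shiftE_basisVec_nil (i : Fin n) (b : List (Fin m)) :
    star (shiftE i) (basisVec [] b) = 0 := by
  refine ext_inner_right ℂ fun v => ?_
  rw [ContinuousLinearMap.star_eq_adjoint, ContinuousLinearMap.adjoint_inner_left,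
    inner_basisVec_nil_shiftE, inner_zero_left]

theorem star_shiftF_mul_shiftF (j l : Fin m) :
    star (shiftF u j) * shiftF u l = if j = l then 1 else 0 := by
  refine ext_basisVec fun a b => ext_inner_left ℂ fun v => ?_
  rw [ContinuousLinearMap.star_eq_adjoint, mul_apply_eq_comp,
    ContinuousLinearMap.adjoint_inner_right, shiftF_basisVec]
  have : (innerSL ℂ (shiftFVec u b a l)).comp (shiftF u j) =
      if j = l then innerSL ℂ (basisVec a b) else 0 := by
    refine ext_basisVec fun a' b' => ?_
    rw [ContinuousLinearMap.comp_apply, shiftF_basisVec, innerSL_apply_apply, inner_shiftFVec]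
    split_ifs <;> simp_all [inner_basisVec, norm_basisVec]
  have h := DFunLike.congr_fun this v
  rw [← inner_conj_symm, ← inner_conj_symm v]
  congr 1
  rw [ContinuousLinearMap.comp_apply, innerSL_apply_apply] at h
  rw [h]
  split_ifs <;> simp

/-- On e_a ⊗ f_b with a empty both sides vanish. Otherwise the vector lies in the range of some
`shiftE k'`, and multiplying by `shiftE k'` on the right reduces both sides to the same sum via
Sᵢ*Sₖ = δᵢₖ. -/
theorem star_shiftE_mul_shiftF (i : Fin n) (l : Fin m) :
    star (shiftE i) * shiftF u l =
      ∑ k, ∑ j, star (coeff u i j k l) • (shiftF u j * star (shiftE k)) := by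
  refine ext_basisVec fun a b => ?_
  cases a with
  | nil => simp [shiftF_basisVec, shiftFVec, star_shiftE_basisVec_nil]
  | cons k' a =>
    have h1 : star (shiftE i) * (shiftF u l * shiftE k') =
        ∑ j, star (coeff u i j k' l) • shiftF u j := by
      rw [shiftF_mul_shiftE]
      simp [Finset.mul_sum, ← mul_assoc, star_shiftE_mul_shiftE]
    have h2 : (∑ k, ∑ j, star (coeff u i j k l) • (shiftF u j * star (shiftE k))) * shiftE k' =
        ∑ j, star (coeff u i j k' l) • shiftF u j := by
      simp [Finset.sum_mul, mul_assoc, star_shiftE_mul_shiftE]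
    rw [← shiftE_basisVec, ← mul_apply_eq_comp, ← mul_apply_eq_comp, mul_assoc, h1, h2]

theorem word_shift_vacuum (a : List (Fin n)) (b : List (Fin m)) :
    ((a.map shiftE).prod * (b.map (shiftF u)).prod : Fock n m →L[ℂ] Fock n m) (basisVec [] []) =
      basisVec a b := by
  induction a with
  | nil =>
    induction b with
    | nil => simp
    | cons l b ih =>
      simp only [List.map_nil, List.prod_nil, one_mul, List.map_cons, List.prod_cons] at ih ⊢
      rw [mul_apply_eq_comp, ih, shiftF_basisVec, shiftFVec]
  | cons i a ih =>
    rw [List.map_cons, List.prod_cons, mul_assoc, mul_apply_eq_comp, ih, shiftE_basisVec]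

theorem fockSystem_shift : FockSystem (coeff u) shiftE (shiftF u) (basisVec [] []) where
  star_left_mul_left := star_shiftE_mul_shiftE
  star_right_mul_right := star_shiftF_mul_shiftF u
  left_mul_right := shiftE_mul_shiftF u
  right_mul_left := shiftF_mul_shiftE u
  star_left_mul_right := star_shiftE_mul_shiftF u
  norm_vacuum := norm_basisVec _ _
  star_left_vacuum i := star_shiftE_basisVec_nil i _
  star_right_vacuum j := by
    refine ext_inner_right ℂ fun v => ?_
    rw [ContinuousLinearMap.star_eq_adjoint, ContinuousLinearMap.adjoint_inner_left,
      inner_zero_left]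
    have : (innerSL ℂ (basisVec [] [])).comp (shiftF u j) = 0 := by
      refine ext_basisVec fun a b => ?_
      rw [ContinuousLinearMap.comp_apply, shiftF_basisVec, innerSL_apply_apply]
      cases a with
      | nil => simp [shiftFVec, inner_basisVec]
      | cons k a => simp [shiftFVec, inner_sum, inner_smul_right, inner_basisVec_nil_shiftE]
    exact DFunLike.congr_fun this v
  cyclic x hx := by
    have : innerSL ℂ x = 0 := by
      refine ext_basisVec fun a b => ?_
      rw [innerSL_apply_apply, ← inner_conj_symm, ← word_shift_vacuum u, hx]
      · simp
      · refine mul_mem (list_prod_mem ?_) (list_prod_mem ?_)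
        · simp only [List.mem_map]
          rintro _ ⟨i, -, rfl⟩
          exact Algebra.subset_adjoin (Or.inl ⟨i, rfl⟩)
        · simp only [List.mem_map]
          rintro _ ⟨i, -, rfl⟩
          exact Algebra.subset_adjoin (Or.inr ⟨i, rfl⟩)
    have h := DFunLike.congr_fun this x
    simpa using h

end FockRepresentation

/-! ### Uniqueness of Fock systems up to unitary equivalence. -/

section Model

variable {n m : ℕ} {H : Type*} [NormedAddCommGroup H] [InnerProductSpace ℂ H] [CompleteSpace H]
  {u : Fin n → Fin m → Fin n → Fin m → ℂ} {S : Fin n → H →L[ℂ] H} {T : Fin m → H →L[ℂ] H} {Ω : H}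

/-- The vector `S_a T_b Ω` for words `a`, `b`. -/
noncomputable def wordVec (S : Fin n → H →L[ℂ] H) (T : Fin m → H →L[ℂ] H) (Ω : H)
    (a : List (Fin n)) (b : List (Fin m)) : H :=
  a.foldr (fun i x => S i x) (b.foldr (fun j x => T j x) Ω)

omit [CompleteSpace H] in
theorem wordVec_cons (i : Fin n) (a : List (Fin n)) (b : List (Fin m)) :
    wordVec S T Ω (i :: a) b = S i (wordVec S T Ω a b) := rfl

omit [CompleteSpace H] in
theorem wordVec_nil_cons (j : Fin m) (b : List (Fin m)) :
    wordVec S T Ω [] (j :: b) = T j (wordVec S T Ω [] b) := rfl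

theorem inner_apply_apply {ι : Type*} [DecidableEq ι] {R : ι → H →L[ℂ] H}
    (hR : ∀ i k, star (R i) * R k = if i = k then 1 else 0) (i k : ι) (x y : H) :
    inner ℂ (R i x) (R k y) = if i = k then inner ℂ x y else (0 : ℂ) := by
  rw [← ContinuousLinearMap.adjoint_inner_right, ← ContinuousLinearMap.star_eq_adjoint,
    ← mul_apply_eq_comp, hR]
  split_ifs <;> simp

namespace FockSystem

/-- The mixed relation moves Sᵢ* past each Tₗ, at the cost of changing the index, until some Sₖ*
meets Ω. -/
theorem star_left_wordVec_nil (h : FockSystem u S T Ω) (i : Fin n) (b : List (Fin m)) :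
    star (S i) (wordVec S T Ω [] b) = 0 := by
  induction b generalizing i with
  | nil => exact h.star_left_vacuum i
  | cons l b ih =>
    rw [wordVec_nil_cons, ← mul_apply_eq_comp, h.star_left_mul_right]
    simp [ih]

theorem inner_left_wordVec_nil (h : FockSystem u S T Ω) (i : Fin n) (b : List (Fin m)) (x : H) :
    inner ℂ (S i x) (wordVec S T Ω [] b) = (0 : ℂ) := by
  rw [← ContinuousLinearMap.adjoint_inner_right, ← ContinuousLinearMap.star_eq_adjoint,
    h.star_left_wordVec_nil, inner_zero_right]

theorem inner_right_vacuum (h : FockSystem u S T Ω) (j : Fin m) (x : H) :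
    inner ℂ (T j x) Ω = (0 : ℂ) := by
  rw [← ContinuousLinearMap.adjoint_inner_right, ← ContinuousLinearMap.star_eq_adjoint,
    h.star_right_vacuum, inner_zero_right]

/-- Equal leading letters cancel by isometry, distinct ones have orthogonal ranges, and words of
different shape are separated by the vacuum conditions. -/
theorem inner_wordVec (h : FockSystem u S T Ω) (a a' : List (Fin n)) (b b' : List (Fin m)) :
    inner ℂ (wordVec S T Ω a b) (wordVec S T Ω a' b') =
      if (a, b) = (a', b') then (1 : ℂ) else 0 := by
  induction a generalizing a' with
  | nil =>
    cases a' with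
    | nil =>
      induction b generalizing b' with
      | nil =>
        cases b' with
        | nil =>
          simp [wordVec, h.norm_vacuum]
        | cons l b' =>
          have := inner_eq_zero_symm.1 (h.inner_right_vacuum l (wordVec S T Ω [] b'))
          rw [if_neg (by simp)]
          exact this
      | cons j b ih =>
        cases b' with
        | nil =>
          have := h.inner_right_vacuum j (wordVec S T Ω [] b)
          rw [if_neg (by simp)]
          exact this
        | cons l b' =>
          rw [wordVec_nil_cons, wordVec_nil_cons, inner_apply_apply h.star_right_mul_right, ih]
          simp [ite_and]
    | cons k a' =>
      have := inner_eq_zero_symm.1 (h.inner_left_wordVec_nil k b (wordVec S T Ω a' b'))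
      rw [if_neg (by simp)]
      exact this
  | cons i a ih =>
    cases a' with
    | nil =>
      have := h.inner_left_wordVec_nil i b' (wordVec S T Ω a b)
      rw [if_neg (by simp)]
      exact this
    | cons k a' =>
      rw [wordVec_cons, wordVec_cons, inner_apply_apply h.star_left_mul_left, ih]
      simp [ite_and]

theorem orthonormal_wordVec (h : FockSystem u S T Ω) :
    Orthonormal ℂ (fun p : List (Fin n) × List (Fin m) => wordVec S T Ω p.1 p.2) := by
  rw [orthonormal_iff_ite]
  rintro ⟨a, b⟩ ⟨a', b'⟩
  exact h.inner_wordVec a a' b b'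

theorem right_wordVec_mem (h : FockSystem u S T Ω) (l : Fin m) (a : List (Fin n))
    (b : List (Fin m)) : T l (wordVec S T Ω a b) ∈
      Submodule.span ℂ (Set.range fun p : List (Fin n) × List (Fin m) => wordVec S T Ω p.1 p.2) := by
  induction a generalizing l with
  | nil => exact Submodule.subset_span ⟨([], l :: b), rfl⟩
  | cons k a ih =>
    rw [wordVec_cons, ← mul_apply_eq_comp, h.right_mul_left]
    simp only [sum_apply, smul_apply, mul_apply_eq_comp]
    refine sum_mem fun i _ => sum_mem fun j _ => Submodule.smul_mem _ _ ?_
    refine Submodule.span_induction (p := fun x _ => S i x ∈ Submodule.span ℂ (Set.range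
      fun p : List (Fin n) × List (Fin m) => wordVec S T Ω p.1 p.2)) ?_ ?_ ?_ ?_ (ih j)
    · rintro _ ⟨p, rfl⟩
      exact Submodule.subset_span ⟨(i :: p.1, p.2), rfl⟩
    · simp
    · intro x y _ _ hx hy
      rw [map_add]
      exact add_mem hx hy
    · intro c x _ hx
      rw [map_smul]
      exact Submodule.smul_mem _ _ hx

/-- The span contains Ω and is invariant under the generated algebra, with T moved past S by the
commutation relation; cyclicity does the rest. -/
theorem orthogonal_span_wordVec (h : FockSystem u S T Ω) :
    (Submodule.span ℂ
      (Set.range fun p : List (Fin n) × List (Fin m) => wordVec S T Ω p.1 p.2))ᗮ = ⊥ := by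
  set W := Submodule.span ℂ
    (Set.range fun p : List (Fin n) × List (Fin m) => wordVec S T Ω p.1 p.2) with hW
  have gen (R : H →L[ℂ] H) (hR : ∀ a b, R (wordVec S T Ω a b) ∈ W) : ∀ x ∈ W, R x ∈ W := by
    intro x hx
    have : W ≤ W.comap (R : H →ₗ[ℂ] H) := by
      rw [hW, Submodule.span_le]
      rintro _ ⟨p, rfl⟩
      exact hR p.1 p.2
    exact this hx
  have inv : ∀ X ∈ Algebra.adjoin ℂ (Set.range S ∪ Set.range T), ∀ x ∈ W, X x ∈ W := by
    intro X hX
    induction hX using Algebra.adjoin_induction with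
    | mem X hX =>
      refine gen X fun a b => ?_
      rcases hX with ⟨i, rfl⟩ | ⟨j, rfl⟩
      · exact Submodule.subset_span ⟨(i :: a, b), rfl⟩
      · exact h.right_wordVec_mem j a b
    | algebraMap c =>
      intro x hx
      rw [Algebra.algebraMap_eq_smul_one]
      exact W.smul_mem _ hx
    | add X Y _ _ hX hY => exact fun x hx => W.add_mem (hX x hx) (hY x hx)
    | mul X Y _ _ hX hY => exact fun x hx => hX _ (hY x hx)
  rw [eq_bot_iff]
  intro x hx
  refine h.cyclic x fun X hX => ?_
  exact (W.mem_orthogonal x).1 hx _ (inv X hX Ω (Submodule.subset_span ⟨([], []), rfl⟩))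

/-- The canonical identification of the Fock space with the space of a Fock system. -/
noncomputable def fockEquiv (h : FockSystem u S T Ω) : Fock n m ≃ₗᵢ[ℂ] H :=
  (HilbertBasis.mkOfOrthogonalEqBot h.orthonormal_wordVec h.orthogonal_span_wordVec).repr.symm

theorem fockEquiv_basisVec (h : FockSystem u S T Ω) (a : List (Fin n)) (b : List (Fin m)) :
    h.fockEquiv (basisVec a b) = wordVec S T Ω a b := by
  rw [fockEquiv, basisVec, HilbertBasis.repr_symm_single]
  simp

end FockSystem

variable {v : Matrix.unitaryGroup (Fin n × Fin m) ℂ}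

theorem FockSystem.fockEquiv_shiftE (h : FockSystem (coeff v) S T Ω) (i : Fin n) (x : Fock n m) :
    h.fockEquiv (shiftE i x) = S i (h.fockEquiv x) := by
  have : (h.fockEquiv : Fock n m →L[ℂ] H).comp (shiftE i) =
      (S i).comp (h.fockEquiv : Fock n m →L[ℂ] H) := by
    refine ext_basisVec fun a b => ?_
    simp [shiftE_basisVec, h.fockEquiv_basisVec, wordVec_cons]
  exact DFunLike.congr_fun this x

theorem FockSystem.fockEquiv_shiftF (h : FockSystem (coeff v) S T Ω) (l : Fin m) (x : Fock n m) :
    h.fockEquiv (shiftF v l x) = T l (h.fockEquiv x) := by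
  have : (h.fockEquiv : Fock n m →L[ℂ] H).comp (shiftF v l) =
      (T l).comp (h.fockEquiv : Fock n m →L[ℂ] H) := by
    refine ext_basisVec fun a b => ?_
    simp only [ContinuousLinearMap.comp_apply, shiftF_basisVec]
    change h.fockEquiv _ = T l (h.fockEquiv (basisVec a b))
    rw [h.fockEquiv_basisVec]
    induction a generalizing l with
    | nil => rw [shiftFVec, h.fockEquiv_basisVec, wordVec_nil_cons]
    | cons k a ih =>
      rw [wordVec_cons, ← mul_apply_eq_comp, h.right_mul_left]
      simp [shiftFVec, Fintype.sum_prod_type, h.fockEquiv_shiftE, ih, coeff]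
  exact DFunLike.congr_fun this x

end Model
-- Closures of subalgebras under automorphisms and characters.
section Closure

variable {A : Type*} [Ring A] [Algebra ℂ A] [TopologicalSpace A] [IsSemitopologicalSemiring A]

theorem map_topologicalClosure_algEquiv (S : Subalgebra ℂ A) (e : A ≃ₐ[ℂ] A) (he : Continuous e)
    (he' : Continuous e.symm) :
    S.topologicalClosure.map (e : A →ₐ[ℂ] A) = (S.map (e : A →ₐ[ℂ] A)).topologicalClosure := by
  apply SetLike.coe_injective
  exact (Homeomorph.mk e.toEquiv he he').image_closure S

/-- The topology is left general so that both the norm and the weak-star topology qualify. -/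
theorem algHom_ext_of_eqOn_topologicalClosure {S : Subalgebra ℂ A}
    {φ ψ : S.topologicalClosure →ₐ[ℂ] ℂ} (hφ : Continuous φ) (hψ : Continuous ψ)
    {G : Set A} (hG : S = Algebra.adjoin ℂ G)
    (h : ∀ X (hX : X ∈ S.topologicalClosure), X ∈ G → φ ⟨X, hX⟩ = ψ ⟨X, hX⟩) : φ = ψ := by
  have hS : ∀ X (hX : X ∈ S), φ ⟨X, S.le_topologicalClosure hX⟩ =
      ψ ⟨X, S.le_topologicalClosure hX⟩ := by
    subst hG
    have : (φ.comp (Subalgebra.inclusion (Subalgebra.le_topologicalClosure _))) =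
        ψ.comp (Subalgebra.inclusion (Subalgebra.le_topologicalClosure _)) := by
      refine AlgHom.adjoin_ext fun X hX => h X _ hX
    intro X hX
    exact DFunLike.congr_fun this ⟨X, hX⟩
  have hd : DenseRange (Set.inclusion (S.le_topologicalClosure : (S : Set A) ⊆ _)) :=
    (denseRange_inclusion_iff _).2 subset_rfl
  refine DFunLike.coe_injective (hd.equalizer hφ hψ ?_)
  funext X
  exact hS X X.2

end Closure

/-! ### Unitary conjugation and the weak-star closure. -/

section WeakStar

variable {H : Type*} [NormedAddCommGroup H] [InnerProductSpace ℂ H] [CompleteSpace H]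

/-- Equality of the norm closures of two algebras therefore already gives equality of their
weak-star closures. -/
theorem weakStarClosure_topologicalClosure (S : Subalgebra ℂ (H →L[ℂ] H)) :
    weakStarClosure S.topologicalClosure = weakStarClosure S := by
  apply SetLike.coe_injective
  rw [coe_weakStarClosure, coe_weakStarClosure]
  apply le_antisymm
  · exact @closure_minimal _ (weakStarTopology H) _ _ (topologicalClosure_le_weakStarClosure S)
      (@isClosed_closure _ (weakStarTopology H) _)
  · exact @closure_mono _ (weakStarTopology H) _ _ S.le_topologicalClosure

theorem map_weakStarClosure_algEquiv (S : Subalgebra ℂ (H →L[ℂ] H))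
    (e : (H →L[ℂ] H) ≃ₐ[ℂ] (H →L[ℂ] H))
    (he : @Continuous _ _ (weakStarTopology H) (weakStarTopology H) e)
    (he' : @Continuous _ _ (weakStarTopology H) (weakStarTopology H) e.symm) :
    (weakStarClosure S).map (e : (H →L[ℂ] H) →ₐ[ℂ] (H →L[ℂ] H)) =
      weakStarClosure (S.map (e : (H →L[ℂ] H) →ₐ[ℂ] (H →L[ℂ] H))) :=
  @map_topologicalClosure_algEquiv _ _ _ (weakStarTopology H) isSemitopologicalSemiring_weakStar
    S e he he'

theorem continuous_weakStar_conj (V W : H →L[ℂ] H) :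
    @Continuous _ _ (weakStarTopology H) (weakStarTopology H) (fun X => V * X * W) := by
  let _ := weakStarTopology H
  have := isSemitopologicalSemiring_weakStar (H := H)
  exact (continuous_mul_const W).comp (continuous_const_mul V)

/-- Conjugation by a unitary operator. -/
noncomputable def conjAlgEquiv (V : unitary (H →L[ℂ] H)) : (H →L[ℂ] H) ≃ₐ[ℂ] (H →L[ℂ] H) :=
  (Unitary.conjStarAlgAut ℂ (H →L[ℂ] H) V).toAlgEquiv

theorem conjAlgEquiv_apply (V : unitary (H →L[ℂ] H)) (X : H →L[ℂ] H) :
    conjAlgEquiv V X = (V : H →L[ℂ] H) * X * star (V : H →L[ℂ] H) := rfl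

theorem conjAlgEquiv_symm_apply (V : unitary (H →L[ℂ] H)) (X : H →L[ℂ] H) :
    (conjAlgEquiv V).symm X = star (V : H →L[ℂ] H) * X * (V : H →L[ℂ] H) := rfl

theorem continuous_conjAlgEquiv (V : unitary (H →L[ℂ] H)) :
    @Continuous _ _ (weakStarTopology H) (weakStarTopology H) (conjAlgEquiv V) :=
  continuous_weakStar_conj _ _

theorem continuous_conjAlgEquiv_symm (V : unitary (H →L[ℂ] H)) :
    @Continuous _ _ (weakStarTopology H) (weakStarTopology H) (conjAlgEquiv V).symm :=
  continuous_weakStar_conj _ _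

theorem map_conjAlgEquiv_weakStarClosure (V : unitary (H →L[ℂ] H))
    (S : Subalgebra ℂ (H →L[ℂ] H)) :
    (weakStarClosure S).map (conjAlgEquiv V : (H →L[ℂ] H) →ₐ[ℂ] (H →L[ℂ] H)) =
      weakStarClosure (S.map (conjAlgEquiv V : (H →L[ℂ] H) →ₐ[ℂ] (H →L[ℂ] H))) :=
  map_weakStarClosure_algEquiv S _ (continuous_conjAlgEquiv V) (continuous_conjAlgEquiv_symm V)

theorem map_conjAlgEquiv_topologicalClosure (V : unitary (H →L[ℂ] H))
    (S : Subalgebra ℂ (H →L[ℂ] H)) :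
    S.topologicalClosure.map (conjAlgEquiv V : (H →L[ℂ] H) →ₐ[ℂ] (H →L[ℂ] H)) =
      (S.map (conjAlgEquiv V : (H →L[ℂ] H) →ₐ[ℂ] (H →L[ℂ] H))).topologicalClosure := by
  refine map_topologicalClosure_algEquiv S _ ?_ ?_
  · have : Continuous fun X : H →L[ℂ] H => (V : H →L[ℂ] H) * X * star (V : H →L[ℂ] H) := by
      fun_prop
    exact this
  · have : Continuous fun X : H →L[ℂ] H => star (V : H →L[ℂ] H) * X * (V : H →L[ℂ] H) := by
      fun_prop
    exact this

end WeakStar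

/-- An algebra automorphism, restricted to a subalgebra that it maps onto itself. -/
def restrictAlgEquiv {A : Type*} [Ring A] [Algebra ℂ A] (e : A ≃ₐ[ℂ] A) (B : Subalgebra ℂ A)
    (h : B.map (e : A →ₐ[ℂ] A) = B) : B ≃ₐ[ℂ] B :=
  (e.subalgebraMap B).trans (Subalgebra.equivOfEq _ _ h)

theorem coe_restrictAlgEquiv {A : Type*} [Ring A] [Algebra ℂ A] (e : A ≃ₐ[ℂ] A)
    (B : Subalgebra ℂ A) (h : B.map (e : A →ₐ[ℂ] A) = B) (X : B) :
    (restrictAlgEquiv e B h X : A) = e X := rfl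

theorem coe_restrictAlgEquiv_symm {A : Type*} [Ring A] [Algebra ℂ A] (e : A ≃ₐ[ℂ] A)
    (B : Subalgebra ℂ A) (h : B.map (e : A →ₐ[ℂ] A) = B) (X : B) :
    ((restrictAlgEquiv e B h).symm X : A) = e.symm X := by
  rw [AlgEquiv.eq_symm_apply, ← coe_restrictAlgEquiv e B h, AlgEquiv.apply_symm_apply]

/-! ### Automorphisms obtained from a Fock system. -/

section Automorphism

variable {n m : ℕ} {u : Matrix.unitaryGroup (Fin n × Fin m) ℂ}
  {S : Fin n → Fock n m →L[ℂ] Fock n m} {T : Fin m → Fock n m →L[ℂ] Fock n m} {Ω : Fock n m}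

namespace FockSystem

/-- The unitary that carries the shifts to a given Fock system. -/
noncomputable def fockUnitary (h : FockSystem (coeff u) S T Ω) :
    unitary (Fock n m →L[ℂ] Fock n m) :=
  Unitary.linearIsometryEquiv.symm h.fockEquiv

theorem conjAlgEquiv_eq_of_intertwines (h : FockSystem (coeff u) S T Ω)
    {X Y : Fock n m →L[ℂ] Fock n m} (hXY : ∀ x, h.fockEquiv (X x) = Y (h.fockEquiv x)) :
    conjAlgEquiv h.fockUnitary X = Y := by
  have h1 : (h.fockUnitary : Fock n m →L[ℂ] Fock n m) * X = Y * h.fockUnitary := by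
    ext1 x
    exact hXY x
  rw [conjAlgEquiv_apply, h1, mul_assoc, Unitary.mul_star_self_of_mem h.fockUnitary.2, mul_one]

theorem map_conj_semigroupAlgebra (h : FockSystem (coeff u) S T Ω) :
    (semigroupAlgebra u).map (conjAlgEquiv h.fockUnitary : (Fock n m →L[ℂ] Fock n m) →ₐ[ℂ] _) =
      Algebra.adjoin ℂ (Set.range S ∪ Set.range T) := by
  have hE : (conjAlgEquiv h.fockUnitary : (Fock n m →L[ℂ] Fock n m) →ₐ[ℂ] _) ∘ shiftE = S := by
    funext i
    exact h.conjAlgEquiv_eq_of_intertwines (h.fockEquiv_shiftE i)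
  have hF : (conjAlgEquiv h.fockUnitary : (Fock n m →L[ℂ] Fock n m) →ₐ[ℂ] _) ∘ shiftF u = T := by
    funext j
    exact h.conjAlgEquiv_eq_of_intertwines (h.fockEquiv_shiftF j)
  rw [semigroupAlgebra, AlgHom.map_adjoin, Set.image_union, ← Set.range_comp, ← Set.range_comp,
    hE, hF]

theorem map_conj_normAlg (h : FockSystem (coeff u) S T Ω)
    (hcl : (Algebra.adjoin ℂ (Set.range S ∪ Set.range T)).topologicalClosure = normAlg u) :
    (normAlg u).map (conjAlgEquiv h.fockUnitary : (Fock n m →L[ℂ] Fock n m) →ₐ[ℂ] _) =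
      normAlg u := by
  rw [normAlg, map_conjAlgEquiv_topologicalClosure, h.map_conj_semigroupAlgebra, hcl, normAlg]

theorem map_conj_weakStarAlg (h : FockSystem (coeff u) S T Ω)
    (hcl : (Algebra.adjoin ℂ (Set.range S ∪ Set.range T)).topologicalClosure = normAlg u) :
    (weakStarAlg u).map (conjAlgEquiv h.fockUnitary : (Fock n m →L[ℂ] Fock n m) →ₐ[ℂ] _) =
      weakStarAlg u := by
  rw [weakStarAlg, map_conjAlgEquiv_weakStarClosure, h.map_conj_semigroupAlgebra,
    ← weakStarClosure_topologicalClosure, hcl, normAlg, weakStarClosure_topologicalClosure]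

theorem exists_automorphism (h : FockSystem (coeff u) S T Ω)
    (hcl : (Algebra.adjoin ℂ (Set.range S ∪ Set.range T)).topologicalClosure = normAlg u) :
    ∃ (Θ : weakStarAlg u ≃ₐ[ℂ] weakStarAlg u) (Ψ : normAlg u ≃ₐ[ℂ] normAlg u),
      UnitarilyImplemented Θ ∧ UnitarilyImplemented Ψ ∧
      @IsHomeomorph _ _ (relWeakStar (weakStarAlg u)) (relWeakStar (weakStarAlg u)) Θ ∧
      (∀ X, Θ (Subalgebra.inclusion (normAlg_le_weakStarAlg u) X) =
        Subalgebra.inclusion (normAlg_le_weakStarAlg u) (Ψ X)) ∧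
      (∀ i, (Ψ.symm ⟨shiftE i, shiftE_mem u i⟩ : Fock n m →L[ℂ] Fock n m) = S i) ∧
      ∀ j, (Ψ.symm ⟨shiftF u j, shiftF_mem u j⟩ : Fock n m →L[ℂ] Fock n m) = T j := by
  have hΘ := h.map_conj_weakStarAlg hcl
  have hΨ := h.map_conj_normAlg hcl
  have hV : star (h.fockUnitary : Fock n m →L[ℂ] Fock n m) ∈
      unitary (Fock n m →L[ℂ] Fock n m) :=
    Unitary.star_mem h.fockUnitary.2
  -- The inverse of conjugation is taken because it is `Θ.symm` that composes with characters, and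
  -- so must send the shifts to `S` and `T`.
  refine ⟨(restrictAlgEquiv (conjAlgEquiv h.fockUnitary) _ hΘ).symm,
    (restrictAlgEquiv (conjAlgEquiv h.fockUnitary) _ hΨ).symm,
    ⟨_, hV, fun X => ?_⟩, ⟨_, hV, fun X => ?_⟩, ?_, fun X => ?_, fun i => ?_, fun j => ?_⟩
  · rw [coe_restrictAlgEquiv_symm, conjAlgEquiv_symm_apply, star_star]
  · rw [coe_restrictAlgEquiv_symm, conjAlgEquiv_symm_apply, star_star]
  · let t := relWeakStar (weakStarAlg u)
    have hc : @Continuous _ _ t (weakStarTopology _)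
        (Subtype.val : weakStarAlg u → Fock n m →L[ℂ] Fock n m) := continuous_induced_dom
    have h1 : @Continuous _ _ t t (restrictAlgEquiv (conjAlgEquiv h.fockUnitary) _ hΘ) :=
      continuous_induced_rng.2 (@Continuous.comp _ _ _ t (weakStarTopology _)
        (weakStarTopology _) _ _ (continuous_conjAlgEquiv _) hc)
    have h2 : @Continuous _ _ t t (restrictAlgEquiv (conjAlgEquiv h.fockUnitary) _ hΘ).symm := by
      refine continuous_induced_rng.2 ?_
      have : (Subtype.val ∘ (restrictAlgEquiv (conjAlgEquiv h.fockUnitary) _ hΘ).symm :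
          weakStarAlg u → Fock n m →L[ℂ] Fock n m) =
          (conjAlgEquiv h.fockUnitary).symm ∘ Subtype.val := by
        funext X
        exact coe_restrictAlgEquiv_symm _ _ _ X
      rw [this]
      exact @Continuous.comp _ _ _ t (weakStarTopology _)
        (weakStarTopology _) _ _ (continuous_conjAlgEquiv_symm _) hc
    exact (@Homeomorph.mk _ _ t t
      (restrictAlgEquiv (conjAlgEquiv h.fockUnitary) _ hΘ).symm.toEquiv h2 h1).isHomeomorph
  · apply Subtype.ext
    rw [coe_restrictAlgEquiv_symm, Subalgebra.coe_inclusion, Subalgebra.coe_inclusion,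
      coe_restrictAlgEquiv_symm]
  · rw [AlgEquiv.symm_symm, coe_restrictAlgEquiv]
    exact h.conjAlgEquiv_eq_of_intertwines (h.fockEquiv_shiftE i)
  · rw [AlgEquiv.symm_symm, coe_restrictAlgEquiv]
    exact h.conjAlgEquiv_eq_of_intertwines (h.fockEquiv_shiftF j)

end FockSystem

end Automorphism

/-! ### Uniqueness of characters and the vacuum character. -/

section Characters

theorem continuous_weakStar_inner {H : Type*} [NormedAddCommGroup H] [InnerProductSpace ℂ H]
    (x y : H) :
    @Continuous _ _ (weakStarTopology H) _ (fun X : H →L[ℂ] H => inner ℂ y (X x)) := by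
  convert continuous_weakStar_pairing (lp.single 2 0 x) (lp.single 2 0 y) using 2 with X
  rw [tsum_eq_single 0]
  · simp
  · intro k hk
    simp [lp.single_apply, hk]

variable {n m : ℕ} {u : Matrix.unitaryGroup (Fin n × Fin m) ℂ}

theorem IsCharacterAt.unique {p : EuclideanSpace ℂ (Fin n) × EuclideanSpace ℂ (Fin m)}
    {φ ψ : normAlg u →ₐ[ℂ] ℂ} (hφ : IsCharacterAt u p φ) (hψ : IsCharacterAt u p ψ) : φ = ψ := by
  have hc : IsClosed (normAlg u : Set (Fock n m →L[ℂ] Fock n m)) :=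
    Subalgebra.isClosed_topologicalClosure _
  -- Completeness makes characters automatically continuous.
  have : CompleteSpace (normAlg u) := hc.completeSpace_coe
  refine algHom_ext_of_eqOn_topologicalClosure (S := semigroupAlgebra u)
    (map_continuous φ) (map_continuous ψ) rfl ?_
  rintro _ hX (⟨i, rfl⟩ | ⟨j, rfl⟩)
  · exact (hφ.1 i).trans (hψ.1 i).symm
  · exact (hφ.2 j).trans (hψ.2 j).symm

theorem IsWeakStarCharacterAt.unique {p : EuclideanSpace ℂ (Fin n) × EuclideanSpace ℂ (Fin m)}
    {φ ψ : weakStarAlg u →ₐ[ℂ] ℂ} (hφ : IsWeakStarCharacterAt u p φ)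
    (hψ : IsWeakStarCharacterAt u p ψ) : φ = ψ := by
  refine @algHom_ext_of_eqOn_topologicalClosure _ _ _ (weakStarTopology _)
    isSemitopologicalSemiring_weakStar (semigroupAlgebra u) φ ψ hφ.1 hψ.1 _ rfl ?_
  rintro _ hX (⟨i, rfl⟩ | ⟨j, rfl⟩)
  · exact (hφ.2.1 i).trans (hψ.2.1 i).symm
  · exact (hφ.2.2 j).trans (hψ.2.2 j).symm

theorem inner_vacuum_shiftE (i : Fin n) (x : Fock n m) :
    inner ℂ (basisVec [] []) (shiftE i x) = (0 : ℂ) :=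
  inner_basisVec_nil_shiftE _ _ _

theorem inner_vacuum_shiftF (j : Fin m) (x : Fock n m) :
    inner ℂ (basisVec [] []) (shiftF u j x) = (0 : ℂ) :=
  inner_eq_zero_symm.1 ((fockSystem_shift u).inner_right_vacuum j x)

/-- Ω is an eigenvector of X*, which is what makes the vacuum state multiplicative. The adjoints of
the generators kill Ω, the property passes to products and sums, and for each fixed x it is
weak-star closed. -/
theorem inner_vacuum_apply {X : Fock n m →L[ℂ] Fock n m} (hX : X ∈ weakStarAlg u)
    (x : Fock n m) : inner ℂ (basisVec [] []) (X x) =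
      inner ℂ (basisVec [] []) (X (basisVec [] [])) * (inner ℂ (basisVec [] []) x : ℂ) := by
  have hs : ∀ X ∈ semigroupAlgebra u, ∀ x : Fock n m, inner ℂ (basisVec [] []) (X x) =
      inner ℂ (basisVec [] []) (X (basisVec [] [])) * (inner ℂ (basisVec [] []) x : ℂ) := by
    intro X hX
    induction hX using Algebra.adjoin_induction with
    | mem X hX =>
      intro x
      rcases hX with ⟨i, rfl⟩ | ⟨j, rfl⟩
      · rw [inner_vacuum_shiftE, inner_vacuum_shiftE, zero_mul]
      · rw [inner_vacuum_shiftF, inner_vacuum_shiftF, zero_mul]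
    | algebraMap c =>
      intro x
      simp [Algebra.algebraMap_eq_smul_one, norm_basisVec]
    | add X Y _ _ hX hY =>
      intro x
      rw [add_apply, add_apply, inner_add_right, inner_add_right, hX x, hY x, add_mul]
    | mul X Y _ _ hX hY =>
      intro x
      rw [mul_apply_eq_comp, mul_apply_eq_comp, hX, hY, hX (Y _), mul_assoc]
  have hc : @IsClosed _ (weakStarTopology (Fock n m)) {X | inner ℂ (basisVec [] []) (X x) =
      inner ℂ (basisVec [] []) (X (basisVec [] [])) * (inner ℂ (basisVec [] []) x : ℂ)} :=
    @isClosed_eq _ _ _ (weakStarTopology (Fock n m)) _ _ _ (continuous_weakStar_inner _ _)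
      (@Continuous.mul _ _ _ _ _ (weakStarTopology (Fock n m)) _ _
        (continuous_weakStar_inner _ _) (@continuous_const _ _ (weakStarTopology (Fock n m)) _ _))
  exact @closure_minimal _ (weakStarTopology (Fock n m)) _ _ (fun X hX => hs X hX x) hc X hX

/-- The vector state of the vacuum, as a character of `ℒᵤ`. -/
noncomputable def vacuumCharacter (u : Matrix.unitaryGroup (Fin n × Fin m) ℂ) :
    weakStarAlg u →ₐ[ℂ] ℂ :=
  AlgHom.ofLinearMap
    { toFun := fun X => inner ℂ (basisVec [] [])
        ((X : Fock n m →L[ℂ] Fock n m) (basisVec [] []))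
      map_add' := fun X Y => by
        rw [Subalgebra.coe_add, add_apply, inner_add_right]
      map_smul' := fun c X => by
        rw [Subalgebra.coe_smul, smul_apply, inner_smul_right]
        rfl }
    (by simp [norm_basisVec])
    (fun X Y => inner_vacuum_apply X.2 _)

theorem isWeakStarCharacterAt_vacuumCharacter (u : Matrix.unitaryGroup (Fin n × Fin m) ℂ) :
    IsWeakStarCharacterAt u (0, 0) (vacuumCharacter u) := by
  refine ⟨?_, fun i => inner_vacuum_shiftE i _, fun j => inner_vacuum_shiftF j _⟩
  exact @Continuous.comp _ _ _ (relWeakStar (weakStarAlg u)) (weakStarTopology (Fock n m)) _ _ _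
    (continuous_weakStar_inner _ _) continuous_induced_dom

end Characters

/-! ### From the core to fixed vectors of the coefficients. -/

section Core

variable {ι κ : Type*} [Fintype ι] [Fintype κ] [DecidableEq ι] [DecidableEq κ]

/-- The hypothesis `hz` says that c, as a matrix, fixes z ⊗ f for every basis vector f, and `hc`
says c*c = 1. Hence c* fixes z ⊗ f too, which is the conjugate of the first half of `FixedBy`. -/
theorem FixedBy.of_mul_eq {c : ι → κ → ι → κ → ℂ} {z : ι → ℂ}
    (hc : ∀ k l i' j', ∑ i, ∑ j, star (c i j k l) * c i j i' j' =
      if (k, l) = (i', j') then 1 else 0)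
    (hz : ∀ i j l, ∑ k, c i j k l * z k = if j = l then z i else 0) :
    FixedBy c (fun i => star (z i)) := by
  have hdual (j : κ) (k : ι) (l : κ) :
      ∑ i, star (c i j k l) * z i = if j = l then z k else 0 := by
    calc ∑ i, star (c i j k l) * z i
        = ∑ i, ∑ j', star (c i j' k l) * ∑ k', c i j' k' j * z k' := by
          simp [hz]
      _ = ∑ k', (∑ i, ∑ j', star (c i j' k l) * c i j' k' j) * z k' := by
          simp only [Finset.mul_sum, Finset.sum_mul, mul_assoc]
          exact (Finset.sum_congr rfl fun i _ => Finset.sum_comm).trans Finset.sum_comm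
      _ = if j = l then z k else 0 := by
          simp only [hc, Prod.mk.injEq, ite_and, ite_mul, one_mul, zero_mul]
          simp [eq_comm]
  refine ⟨fun j k l => ?_, fun i j l => by simpa using hz i j l⟩
  have := congrArg star (hdual j k l)
  simpa [star_sum, apply_ite, mul_comm] using this

omit [Fintype κ] [DecidableEq ι] in
-- Passing from c to its adjoint exchanges the two halves of the definition. `flipCoeff` is such an
-- adjoint with the index pairs reversed.
theorem FixedBy.star_swap {c : ι → κ → ι → κ → ℂ} {z : ι → ℂ}
    (h : FixedBy c (fun i => star (z i))) :
    FixedBy (fun i j k l => star (c k l i j)) (fun i => star (z i)) where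
  sum_fst j k l := by
    have := congrArg star (h.sum_snd k l j)
    simpa [star_sum, apply_ite, mul_comm, eq_comm] using this
  sum_snd i j l := by
    have := congrArg star (h.sum_fst l i j)
    simpa [star_sum, apply_ite, mul_comm, eq_comm] using this

variable {n m : ℕ} {u : Matrix.unitaryGroup (Fin n × Fin m) ℂ}
  {z : EuclideanSpace ℂ (Fin n)} {w : EuclideanSpace ℂ (Fin m)}

theorem fixedBy_coeff (h : (z, w) ∈ core u) : FixedBy (coeff u) (fun i => star (z i)) := by
  refine FixedBy.of_mul_eq (fun k l i' j' => sum_star_coeff_mul u i' k j' l) fun i j l => ?_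
  have h1 := congrFun (h.2.2 i j).2 l
  simp only [Matrix.mulVec, dotProduct, coreMatrix, Matrix.transpose_apply, Matrix.sub_apply,
    Matrix.of_apply, sub_mul, Finset.sum_sub_distrib, Pi.zero_apply, sub_eq_zero] at h1
  simp only [coeff]
  rw [h1]
  simp [Matrix.single_apply, ite_and]

theorem fixedBy_flipCoeff (h : (z, w) ∈ core u) :
    FixedBy (flipCoeff (coeff u)) (fun j => star (w j)) := by
  refine FixedBy.star_swap (c := fun j i l k => coeff u i j k l)
    (FixedBy.of_mul_eq (fun l k j' i' => ?_) fun j i k => ?_)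
  · rw [Finset.sum_comm, sum_star_coeff_mul u i' k j' l]
    simp [and_comm]
  · have h1 := congrFun (h.2.2 i j).1 k
    simp only [Matrix.mulVec, dotProduct, coreMatrix, Matrix.sub_apply,
      Matrix.of_apply, sub_mul, Finset.sum_sub_distrib, Pi.zero_apply, sub_eq_zero] at h1
    simp only [coeff]
    rw [h1]
    simp [Matrix.single_apply, ite_and]

theorem sum_star_mul_eq_one_sub_sq (hz : ‖z‖ < 1) :
    0 < √(1 - ‖z‖ ^ 2) ∧ √(1 - ‖z‖ ^ 2) ≤ 1 ∧
      ∑ i, star (star (z i)) * star (z i) = 1 - ((√(1 - ‖z‖ ^ 2) : ℝ) : ℂ) ^ 2 := by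
  have h0 : 0 < 1 - ‖z‖ ^ 2 := by nlinarith [norm_nonneg z]
  refine ⟨Real.sqrt_pos.2 h0, Real.sqrt_le_one.2 (by nlinarith [norm_nonneg z]), ?_⟩
  rw [← Complex.ofReal_pow, Real.sq_sqrt h0.le, EuclideanSpace.norm_sq_eq]
  simp [Complex.mul_conj']

end Core

/-! ### Values of characters on transformed generators. -/

section Evaluation

variable {ι H : Type*} [Fintype ι] [NormedAddCommGroup H] [InnerProductSpace ℂ H]

/-- Apply φ to (1 - Y)Mᵢ = ȳᵢ - sRᵢ - ȳᵢ/(1 + s)Y. Since φ(Y) = 0, the resolvent itself is never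
evaluated and need not lie in B. -/
theorem algHom_mobius_eq {B : Subalgebra ℂ (H →L[ℂ] H)} (φ : B →ₐ[ℂ] ℂ) {R : ι → H →L[ℂ] H}
    (hR : ∀ i, R i ∈ B) (hφ : ∀ i, φ ⟨R i, hR i⟩ = 0) {y : ι → ℂ} {s : ℝ}
    (hu : IsUnit (1 - ∑ k, y k • R k)) (i : ι) (hM : mobius y s R i ∈ B) :
    φ ⟨mobius y s R i, hM⟩ = star (y i) := by
  have hsmul (c : ℂ) (X : B) : φ (c • X) = c * φ X := φ.toLinearMap.map_smul c X
  have hY : φ (∑ k, y k • (⟨R k, hR k⟩ : B)) = 0 := by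
    rw [map_sum]
    simp only [hsmul, hφ, mul_zero, Finset.sum_const_zero]
  have h1 : (1 - ∑ k, y k • (⟨R k, hR k⟩ : B)) * ⟨mobius y s R i, hM⟩ =
      star (y i) • (1 : B) - (s : ℂ) • ⟨R i, hR i⟩ -
        (star (y i) / (1 + s)) • ∑ k, y k • (⟨R k, hR k⟩ : B) := by
    apply Subtype.ext
    simpa using one_sub_mul_mobius (s := s) hu i
  have h2 := congrArg φ h1
  rw [map_mul, map_sub, map_sub, map_sub, hsmul, hsmul, hsmul, hY, hφ, map_one] at h2
  simpa using h2

end Evaluation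

/-! ### Transport of characters to points of the core. -/

section Transfer

variable {n m : ℕ} {u : Matrix.unitaryGroup (Fin n × Fin m) ℂ}
  {p q : EuclideanSpace ℂ (Fin n) × EuclideanSpace ℂ (Fin m)}
  {z : EuclideanSpace ℂ (Fin n)} {w : EuclideanSpace ℂ (Fin m)}

/-- A pair of compatible automorphisms of `𝒜ᵤ` and `ℒᵤ`, unitarily implemented, that carries the
character at `p` to the character at `q`. -/
structure CarriesCharacter (u : Matrix.unitaryGroup (Fin n × Fin m) ℂ)
    (p q : EuclideanSpace ℂ (Fin n) × EuclideanSpace ℂ (Fin m))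
    (Θ : weakStarAlg u ≃ₐ[ℂ] weakStarAlg u) (Ψ : normAlg u ≃ₐ[ℂ] normAlg u) : Prop where
  implemented : UnitarilyImplemented Θ
  implemented_normAlg : UnitarilyImplemented Ψ
  isHomeomorph : @IsHomeomorph _ _ (relWeakStar (weakStarAlg u)) (relWeakStar (weakStarAlg u)) Θ
  restricts : ∀ X, Θ (Subalgebra.inclusion (normAlg_le_weakStarAlg u) X) =
    Subalgebra.inclusion (normAlg_le_weakStarAlg u) (Ψ X)
  isCharacterAt : ∀ φ : normAlg u →ₐ[ℂ] ℂ, IsCharacterAt u p φ →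
    IsCharacterAt u q (φ.comp Ψ.symm.toAlgHom)

theorem CarriesCharacter.isWeakStarCharacterAt {Θ : weakStarAlg u ≃ₐ[ℂ] weakStarAlg u}
    {Ψ : normAlg u ≃ₐ[ℂ] normAlg u} (h : CarriesCharacter u p q Θ Ψ)
    {φ : weakStarAlg u →ₐ[ℂ] ℂ} (hφ : IsWeakStarCharacterAt u p φ) :
    IsWeakStarCharacterAt u q (φ.comp Θ.symm.toAlgHom) := by
  refine ⟨?_, ?_⟩
  · let t := relWeakStar (weakStarAlg u)
    have h1 : @Continuous _ _ t t Θ.symm :=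
      (@IsHomeomorph.homeomorph _ _ t t Θ h.isHomeomorph).symm.continuous.congr fun X => by
        rw [AlgEquiv.eq_symm_apply]
        exact (@IsHomeomorph.homeomorph _ _ t t Θ h.isHomeomorph).apply_symm_apply X
    have h2 : @Continuous _ _ t _ (φ ∘ Θ.symm) := @Continuous.comp _ _ _ t t _ _ _ hφ.1 h1
    exact h2
  · have h1 := h.isCharacterAt _ hφ.2
    convert h1 using 1
    ext X
    simp only [AlgHom.comp_apply]
    congr 1
    change Θ.symm _ = Subalgebra.inclusion (normAlg_le_weakStarAlg u) (Ψ.symm X)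
    rw [AlgEquiv.symm_apply_eq, h.restricts, AlgEquiv.apply_symm_apply]

/-- The core gives a compatible pair of automorphisms that moves the first coordinate of a
character from `0` to `z`. -/
theorem exists_carriesCharacter_fst (hcore : (z, w) ∈ core u) (hz : ‖z‖ < 1) :
    ∃ Θ Ψ, CarriesCharacter u (0, w) (z, w) Θ Ψ := by
  obtain ⟨hs, hs1, hy⟩ := sum_star_mul_eq_one_sub_sq hz
  have h := fockSystem_shift u
  have h1 := h.mobius (fixedBy_coeff hcore) hs hs1 hy
  have hcl := topologicalClosure_adjoin_mobius (T := shiftF u) h.star_left_mul_left hs hs1 hy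
  obtain ⟨Θ, Ψ, hΘ, hΨ, hhom, hres, hE, hF⟩ := h1.exists_automorphism hcl
  refine ⟨Θ, Ψ, hΘ, hΨ, hhom, hres, fun φ hφ => ⟨fun i => ?_, fun j => ?_⟩⟩
  · have hu := isUnit_one_sub_of_norm_lt_one
      (norm_sum_smul_lt_one h.star_left_mul_left hs hs1 hy)
    have hM : mobius (fun i => star (z i)) (√(1 - ‖z‖ ^ 2)) shiftE i ∈ normAlg u :=
      hE i ▸ (Ψ.symm ⟨shiftE i, shiftE_mem u i⟩).2
    have h2 : Ψ.symm ⟨shiftE i, shiftE_mem u i⟩ = ⟨_, hM⟩ := Subtype.ext (hE i)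
    change φ (Ψ.symm ⟨shiftE i, shiftE_mem u i⟩) = _
    rw [h2, algHom_mobius_eq φ (fun i => shiftE_mem u i) (fun i => by simpa using hφ.1 i) hu i hM,
      star_star]
  · change φ (Ψ.symm ⟨shiftF u j, shiftF_mem u j⟩) = _
    have h2 : Ψ.symm ⟨shiftF u j, shiftF_mem u j⟩ = ⟨_, shiftF_mem u j⟩ := Subtype.ext (hF j)
    rw [h2]
    exact hφ.2 j

/-- The core gives a compatible pair of automorphisms that moves a character from the origin to
`(z, w)`. -/
theorem exists_carriesCharacter (hcore : (z, w) ∈ core u) (hz : ‖z‖ < 1) (hw : ‖w‖ < 1) :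
    ∃ Θ Ψ, CarriesCharacter u (0, 0) (z, w) Θ Ψ := by
  obtain ⟨hs, hs1, hy⟩ := sum_star_mul_eq_one_sub_sq hz
  obtain ⟨ht, ht1, hx⟩ := sum_star_mul_eq_one_sub_sq hw
  have h := fockSystem_shift u
  have h1 := h.mobius (fixedBy_coeff hcore) hs hs1 hy
  -- The first transform leaves T unchanged, so the flipped system has `shiftF u` as its left tuple
  -- and can be transformed with parameter w̄.
  have h2 := (h1.flip.mobius (fixedBy_flipCoeff hcore) ht ht1 hx).flip
  rw [flipCoeff_flipCoeff] at h2
  have hcl := topologicalClosure_adjoin_mobius (T := shiftF u) h.star_left_mul_left hs hs1 hy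
  have hcl2 := topologicalClosure_adjoin_mobius
    (T := mobius (fun i => star (z i)) (√(1 - ‖z‖ ^ 2)) shiftE)
    h.star_right_mul_right ht ht1 hx
  -- Undoing the transform of T and then that of S keeps the norm closed algebra fixed at each
  -- stage.
  rw [Set.union_comm, Set.union_comm (Set.range (shiftF u)), hcl] at hcl2
  obtain ⟨Θ, Ψ, hΘ, hΨ, hhom, hres, hE, hF⟩ := h2.exists_automorphism hcl2
  refine ⟨Θ, Ψ, hΘ, hΨ, hhom, hres, fun φ hφ => ⟨fun i => ?_, fun j => ?_⟩⟩
  · have hu := isUnit_one_sub_of_norm_lt_one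
      (norm_sum_smul_lt_one h.star_left_mul_left hs hs1 hy)
    have hM : mobius (fun i => star (z i)) (√(1 - ‖z‖ ^ 2)) shiftE i ∈ normAlg u :=
      hE i ▸ (Ψ.symm ⟨shiftE i, shiftE_mem u i⟩).2
    have h2 : Ψ.symm ⟨shiftE i, shiftE_mem u i⟩ = ⟨_, hM⟩ := Subtype.ext (hE i)
    change φ (Ψ.symm ⟨shiftE i, shiftE_mem u i⟩) = _
    rw [h2, algHom_mobius_eq φ (fun i => shiftE_mem u i) (fun i => by simpa using hφ.1 i) hu i hM,
      star_star]
  · have hu := isUnit_one_sub_of_norm_lt_one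
      (norm_sum_smul_lt_one h.star_right_mul_right ht ht1 hx)
    have hM : mobius (fun j => star (w j)) (√(1 - ‖w‖ ^ 2)) (shiftF u) j ∈ normAlg u :=
      hF j ▸ (Ψ.symm ⟨shiftF u j, shiftF_mem u j⟩).2
    have h2 : Ψ.symm ⟨shiftF u j, shiftF_mem u j⟩ = ⟨_, hM⟩ := Subtype.ext (hF j)
    change φ (Ψ.symm ⟨shiftF u j, shiftF_mem u j⟩) = _
    rw [h2, algHom_mobius_eq φ (fun j => shiftF_mem u j) (fun j => by simpa using hφ.2 j) hu j hM,
      star_star]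

theorem exists_isWeakStarCharacterAt (hcore : (z, w) ∈ core u) (hz : ‖z‖ < 1) (hw : ‖w‖ < 1) :
    ∃ φ, IsWeakStarCharacterAt u (z, w) φ :=
  let ⟨_, _, h⟩ := exists_carriesCharacter hcore hz hw
  ⟨_, h.isWeakStarCharacterAt (isWeakStarCharacterAt_vacuumCharacter u)⟩

/-- This makes existence of the character at (0, w) a case of the existence result for core points.
-/
theorem zero_left_mem_core (hcore : (z, w) ∈ core u) : (0, w) ∈ core u :=
  ⟨by simp, hcore.2.1, fun i j => ⟨(hcore.2.2 i j).1, by simp⟩⟩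

end Transfer

end UnitaryRelation

open UnitaryRelation

theorem proposition4p6 {n m : ℕ} (u : Matrix.unitaryGroup (Fin n × Fin m) ℂ)
    (z : EuclideanSpace ℂ (Fin n)) (w : EuclideanSpace ℂ (Fin m))
    (hcore : (z, w) ∈ core u) (hz : ‖z‖ < 1) (hw : ‖w‖ < 1) :
    -- the automorphism of the norm closed algebra, carrying (0, w) to (z, w)
    ((∃! φ : normAlg u →ₐ[ℂ] ℂ, IsCharacterAt u (0, w) φ) ∧
      (∃! φ : normAlg u →ₐ[ℂ] ℂ, IsCharacterAt u (z, w) φ) ∧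
      ∃ Θ : normAlg u ≃ₐ[ℂ] normAlg u,
        UnitarilyImplemented Θ ∧
        ∀ φ₀ φ : normAlg u →ₐ[ℂ] ℂ,
          IsCharacterAt u (0, w) φ₀ →
          IsCharacterAt u (z, w) φ → ∀ X, φ₀ (Θ.symm X) = φ X) ∧
    -- the automorphism of the weak-star closed algebra, carrying (0, 0) to (z, w)
    ((∃! φ : weakStarAlg u →ₐ[ℂ] ℂ,
        IsWeakStarCharacterAt u (0, 0) φ) ∧
      (∃! φ : weakStarAlg u →ₐ[ℂ] ℂ,
        IsWeakStarCharacterAt u (z, w) φ) ∧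
      ∃ Θ : weakStarAlg u ≃ₐ[ℂ] weakStarAlg u,
        UnitarilyImplemented Θ ∧
        @IsHomeomorph _ _ (relWeakStar (weakStarAlg u))
          (relWeakStar (weakStarAlg u)) Θ ∧
        (∃ Ψ : normAlg u ≃ₐ[ℂ] normAlg u, ∀ X,
          Θ (Subalgebra.inclusion (normAlg_le_weakStarAlg u) X) =
            Subalgebra.inclusion (normAlg_le_weakStarAlg u) (Ψ X)) ∧
        ∀ φ₀ φ : weakStarAlg u →ₐ[ℂ] ℂ,
          IsWeakStarCharacterAt u (0, 0) φ₀ →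
          IsWeakStarCharacterAt u (z, w) φ → ∀ X, φ₀ (Θ.symm X) = φ X) := by
  have hexists {z' : EuclideanSpace ℂ (Fin n)} (h : (z', w) ∈ core u) (hz' : ‖z'‖ < 1) :
      ∃! φ : normAlg u →ₐ[ℂ] ℂ, IsCharacterAt u (z', w) φ := by
    obtain ⟨φ, hφ⟩ := exists_isWeakStarCharacterAt h hz' hw
    exact ⟨_, hφ.2, fun ψ hψ => hψ.unique hφ.2⟩
  refine ⟨⟨hexists (zero_left_mem_core hcore) (by simp), hexists hcore hz, ?_⟩, ?_, ?_, ?_⟩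
  · obtain ⟨Θ, Ψ, h⟩ := exists_carriesCharacter_fst hcore hz
    refine ⟨Ψ, h.implemented_normAlg, fun φ₀ φ hφ₀ hφ X => ?_⟩
    exact DFunLike.congr_fun ((h.isCharacterAt φ₀ hφ₀).unique hφ) X
  · exact ⟨_, isWeakStarCharacterAt_vacuumCharacter u,
      fun ψ hψ => hψ.unique (isWeakStarCharacterAt_vacuumCharacter u)⟩
  · obtain ⟨φ, hφ⟩ := exists_isWeakStarCharacterAt hcore hz hw
    exact ⟨φ, hφ, fun ψ hψ => hψ.unique hφ⟩
  · obtain ⟨Θ, Ψ, h⟩ := exists_carriesCharacter hcore hz hw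
    refine ⟨Θ, h.implemented, h.isHomeomorph, ⟨Ψ, h.restricts⟩, fun φ₀ φ hφ₀ hφ X => ?_⟩
    exact DFunLike.congr_fun ((h.isWeakStarCharacterAt hφ₀).unique hφ) X
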